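/- A \emph{positively ordered monoid} is a commutative monoid with a translation-invariant partial order whose least element is $0$. In a partially ordered set, $x\ll y$ means that for every increasing sequence $(y_n)_n$ that has a supremum with $y\le\sup_n y_n$ there is $k$ with $x\le y_k$. A \emph{$\mathrm{Cu}$-semigroup} is a positively ordered monoid $S$ such that (O1) every increasing sequence has a supremum; (O2) every element is the supremum of a $\ll$-increasing sequence; (O3) $x'\ll x$ and $y'\ll y$ imply $x'+y'\ll x+y$; (O4) $\sup_n(x_n+y_n)=\sup_n x_n+\sup_n y_n$ for increasing sequences. A \emph{$\mathrm{Cu}$-morphism} is an order-preserving monoid homomorphism that preserves $\ll$ and suprema of increasing sequences. These form the category $\mathrm{Cu}$. An \emph{ideal} of $S$ is a downward hereditary submonoid closed under suprema of increasing sequences. A \emph{scale} for $S$ is a downward hereditary subset $\Sigma\subseteq S$ that is closed under suprema of increasing sequences and generates $S$ as an ideal. The category $\mathrm{Cu}_{\mathrm{sc}}$ has as objects the pairs $(S,\Sigma)$ of a $\mathrm{Cu}$-semigroup and a scale, and as morphisms $(S,\Sigma)\to(T,\Theta)$ the $\mathrm{Cu}$-morphisms $\alpha\colon S\to T$ with $\alpha(\Sigma)\subseteq\Theta$.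 Let $S$ be a positively ordered monoid that satisfies (O1) and (O4), with an additive auxiliary relation $\prec$, that is, $x\prec y$ implies $x\le y$; $w\le x\prec y\le z$ implies $w\prec z$; $0\prec x$ for all $x$; and $\prec$ is compatible with addition. A \emph{path} in $S$ is an order-preserving map $f\colon(-\infty,0]\to S$ with $f(t)=\sup_{t'<t}f(t')$ for all $t$ and $f(t')\prec f(t)$ whenever $t'<t$. Write $f\precsim g$ if for every $t<0$ there is $t'<0$ with $f(t)\prec g(t')$. Then $\tau(S,\prec)$ is the set of classes $[f]$ of paths modulo $f\sim g\Leftrightarrow f\precsim g\precsim f$, with $[f]+[g]=[f+g]$, and $[f]\le[g]$ if and only if $f\precsim g$. \textbf{Theorem.} The category $\mathrm{Cu}_{\mathrm{sc}}$ is bicomplete: it has all small limits and all small colimits. More precisely, let $I$ be a small category and let $F\colon I\to\mathrm{Cu}_{\mathrm{sc}}$, $i\mapsto(S_i,\Sigma_i)$, be a functor. (1) Let $S=\{(s_i)_i\in\prod_i S_i : F(f)(s_i)=s_j \text{ for all } f\colon i\to j\}$, with componentwise addition and order, and with the relation $s\ll_{\mathrm{pw}}t$ if and only if $s_i\ll t_i$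 in $S_i$ for all $i$. Let $\psi_i\colon\tau(S,\ll_{\mathrm{pw}})\to S_i$, $\psi_i([f])=f(0)_i$. Then $\tau(S,\ll_{\mathrm{pw}})$ is a $\mathrm{Cu}$-semigroup which, with the maps $\psi_i$, is the limit of the underlying functor $I\to\mathrm{Cu}$, $i\mapsto S_i$. Set $$\Sigma=\Big\{[f]\in\tau(S,\ll_{\mathrm{pw}}) : f(t)\in\textstyle\prod_i\Sigma_i\text{ for all }t<0\Big\}$$ and let $\langle\Sigma\rangle$ be the ideal of $\tau(S,\ll_{\mathrm{pw}})$ generated by $\Sigma$. Then $(\langle\Sigma\rangle,\Sigma)$ is a scaled $\mathrm{Cu}$-semigroup, the restrictions of the $\psi_i$ to $\langle\Sigma\rangle$ are morphisms $(\langle\Sigma\rangle,\Sigma)\to(S_i,\Sigma_i)$ in $\mathrm{Cu}_{\mathrm{sc}}$, and $(\langle\Sigma\rangle,\Sigma)$ with these restrictions is a limit of $F$ in $\mathrm{Cu}_{\mathrm{sc}}$. (2) The underlying functor $I\to\mathrm{Cu}$, $i\mapsto S_i$, has a colimit. Let $(S,(\sigma_i)_i)$ be any such colimit, and let $\Sigma$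 be the smallest subset of $S$ that contains $\bigcup_i\sigma_i(\Sigma_i)$, is downward hereditary, and is closed under suprema of increasing sequences. Then $$\Sigma=\Big\{x\in S : \text{for every } x'\ll x \text{ there is } y\in\textstyle\bigcup_i\sigma_i(\Sigma_i)\text{ with }x'\le y\Big\},$$ $(S,\Sigma)$ is a scaled $\mathrm{Cu}$-semigroup, and $(S,\Sigma)$ with the maps $\sigma_i$ is a colimit of $F$ in $\mathrm{Cu}_{\mathrm{sc}}$. -/

import Mathlib

universe u

open CategoryTheory CategoryTheory.Limits

namespace Cuntz

/-! ### Positively ordered monoids and Cu-semigroups -/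

/-- A positively ordered monoid: a commutative monoid with a translation-invariant partial order
whose least element is `0`.  Its morphisms are the maps `M →+o N` that preserve addition, zero and
order. -/
class PosOrdMonoid (M : Type u) extends AddCommMonoid M, PartialOrder M, IsOrderedAddMonoid M where
  zero_le_all : ∀ x : M, 0 ≤ x

/-- `x` is (sequentially) way below `y`. -/
def WayBelow {M : Type u} [PosOrdMonoid M] (x y : M) : Prop :=
  ∀ s : ℕ → M, Monotone s → ∀ z : M, IsLUB (Set.range s) z → y ≤ z → ∃ k, x ≤ s k

/-- Increasing sequences have suprema. -/
def AxiomO1 (M : Type u) [PosOrdMonoid M] : Prop :=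
  ∀ s : ℕ → M, Monotone s → ∃ z : M, IsLUB (Set.range s) z

/-- Addition is compatible with suprema of increasing sequences. -/
def AxiomO4 (M : Type u) [PosOrdMonoid M] : Prop :=
  ∀ s t : ℕ → M, Monotone s → Monotone t → ∀ x y : M,
    IsLUB (Set.range s) x → IsLUB (Set.range t) y → IsLUB (Set.range fun n => s n + t n) (x + y)

/-- Abstract Cuntz semigroups. -/
structure IsCuSemigroup (M : Type u) [PosOrdMonoid M] : Prop where
  o1 : AxiomO1 M
  o2 : ∀ x : M, ∃ s : ℕ → M, (∀ n, WayBelow (s n) (s (n + 1))) ∧ IsLUB (Set.range s) x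
  o3 : ∀ x' x y' y : M, WayBelow x' x → WayBelow y' y → WayBelow (x' + y') (x + y)
  o4 : AxiomO4 M

/-- The map `f` preserves suprema of increasing sequences. -/
def PreservesSeqSup {M N : Type u} [PosOrdMonoid M] [PosOrdMonoid N] (f : M →+o N) : Prop :=
  ∀ s : ℕ → M, Monotone s → ∀ z : M, IsLUB (Set.range s) z → IsLUB (Set.range fun n => f (s n)) (f z)

/-- Cu-morphisms. -/
structure IsCuMorphism {M N : Type u} [PosOrdMonoid M] [PosOrdMonoid N] (f : M →+o N) : Prop where
  map_wayBelow : ∀ x y : M, WayBelow x y → WayBelow (f x) (f y)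
  map_sup : PreservesSeqSup f

/-- The subset `A` is closed under suprema of increasing sequences. -/
def SeqSupClosed {M : Type u} [PosOrdMonoid M] (A : Set M) : Prop :=
  ∀ s : ℕ → M, Monotone s → (∀ n, s n ∈ A) → ∀ z : M, IsLUB (Set.range s) z → z ∈ A

/-- Ideals of Cu-semigroups. -/
def IsCuIdeal {M : Type u} [PosOrdMonoid M] (I : AddSubmonoid M) : Prop :=
  IsLowerSet (I : Set M) ∧ SeqSupClosed (I : Set M)

/-- The ideal generated by a subset, the intersection of all ideals that contain it. -/
def idealGen {M : Type u} [PosOrdMonoid M] (A : Set M) : AddSubmonoid M :=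
  sInf {I | IsCuIdeal I ∧ A ⊆ I}

/-- Scales.  (The empty set is a scale for the zero semigroup, and only for that one.) -/
structure IsScale {M : Type u} [PosOrdMonoid M] (A : Set M) : Prop where
  lower : IsLowerSet A
  supClosed : SeqSupClosed A
  generates : idealGen A = ⊤

/-! ### The categories of Cu-semigroups and of scaled Cu-semigroups -/

/-- Bundled Cu-semigroups. -/
structure CuCat : Type (u + 1) where
  carrier : Type u
  [pom : PosOrdMonoid carrier]
  isCu : IsCuSemigroup carrier

attribute [instance] CuCat.pom

/-- Morphisms in `CuCat`. -/
@[ext]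
structure CuCat.Hom (S T : CuCat.{u}) : Type u where
  hom : S.carrier →+o T.carrier
  isCu : IsCuMorphism hom

theorem isCuMorphism_id (M : Type u) [PosOrdMonoid M] : IsCuMorphism (OrderAddMonoidHom.id M) :=
  ⟨fun _ _ h => h, fun _ _ _ h => h⟩

theorem IsCuMorphism.comp {M N P : Type u} [PosOrdMonoid M] [PosOrdMonoid N] [PosOrdMonoid P]
    {g : N →+o P} {f : M →+o N} (hg : IsCuMorphism g) (hf : IsCuMorphism f) :
    IsCuMorphism (g.comp f) :=
  ⟨fun _ _ h => hg.map_wayBelow _ _ (hf.map_wayBelow _ _ h),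
    fun s hs z h => hg.map_sup (fun n => f (s n)) (fun _ _ hab => f.monotone' (hs hab)) _
      (hf.map_sup s hs z h)⟩

instance : Category.{u} CuCat.{u} where
  Hom S T := CuCat.Hom S T
  id S := ⟨OrderAddMonoidHom.id S.carrier, isCuMorphism_id _⟩
  comp f g := ⟨g.hom.comp f.hom, g.isCu.comp f.isCu⟩

/-- Bundled scaled Cu-semigroups. -/
structure CuSc : Type (u + 1) where
  toCu : CuCat.{u}
  scale : Set toCu.carrier
  isScale : IsScale scale

/-- Morphisms in `CuSc`: Cu-morphisms that map the scale into the scale. -/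
@[ext]
structure CuSc.Hom (S T : CuSc.{u}) : Type u where
  toCu : S.toCu ⟶ T.toCu
  map_scale : ∀ x ∈ S.scale, CuCat.Hom.hom toCu x ∈ T.scale

instance : Category.{u} CuSc.{u} where
  Hom S T := CuSc.Hom S T
  id S := ⟨𝟙 S.toCu, fun _ h => h⟩
  comp f g := ⟨f.toCu ≫ g.toCu, fun x h => g.map_scale _ (f.map_scale x h)⟩

/-- The functor that forgets the scale. -/
def forgetScale : CuSc.{u} ⥤ CuCat.{u} where
  obj S := S.toCu
  map f := CuSc.Hom.toCu f

/-! ### The τ-construction -/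

/-- The additional structure that makes a positively ordered monoid a Q-semigroup: axioms O1 and O4
hold, and there is an additive auxiliary relation `prec`. -/
class QSemigroup (M : Type u) [PosOrdMonoid M] where
  prec : M → M → Prop
  o1 : AxiomO1 M
  o4 : AxiomO4 M
  le_of_prec : ∀ x y : M, prec x y → x ≤ y
  prec_mono : ∀ w x y z : M, w ≤ x → prec x y → y ≤ z → prec w z
  zero_prec : ∀ x : M, prec 0 x
  prec_add : ∀ x' x y' y : M, prec x' x → prec y' y → prec (x' + y') (x + y)

/-- Paths `(-∞, 0] → M` in a Q-semigroup. -/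
structure TauPath (M : Type u) [PosOrdMonoid M] [QSemigroup M] : Type u where
  toFun : Set.Iic (0 : ℝ) → M
  mono : Monotone toFun
  sup : ∀ t, IsLUB (toFun '' Set.Iio t) (toFun t)
  prec : ∀ t' t, t' < t → QSemigroup.prec (toFun t') (toFun t)

namespace TauPath

/-- A path is a supremum along a sequence that increases to the given time. -/
theorem exists_seq {M : Type u} [PosOrdMonoid M] (t : Set.Iic (0 : ℝ)) : ∃ a : ℕ → Set.Iic (0 : ℝ), Monotone a ∧
    (∀ n, a n < t) ∧ ∀ f : Set.Iic (0 : ℝ) → M, Monotone f → ∀ z : M,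
      IsLUB (f '' Set.Iio t) z ↔ IsLUB (Set.range fun n => f (a n)) z := by
  obtain ⟨b, hb, hlt, hlim⟩ := exists_seq_strictMono_tendsto (t : ℝ)
  refine ⟨fun n => ⟨b n, (hlt n).le.trans t.2⟩, fun i j h => hb.monotone h, fun n => hlt n, ?_⟩
  intro f hf z
  have : upperBounds (f '' Set.Iio t) =
      upperBounds (Set.range fun n => f ⟨b n, (hlt n).le.trans t.2⟩) := by
    ext w
    constructor
    · rintro h _ ⟨n, rfl⟩
      exact h ⟨_, hlt n, rfl⟩
    · rintro h _ ⟨s, hs, rfl⟩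
      obtain ⟨n, hn⟩ := (hlim.eventually (lt_mem_nhds (show (s : ℝ) < t from hs))).exists
      exact (hf (show s ≤ ⟨b n, _⟩ from hn.le)).trans (h ⟨n, rfl⟩)
  unfold IsLUB
  rw [this]

variable {M : Type u} [PosOrdMonoid M] [QSemigroup M]

/-- The zero path. -/
def zero : TauPath M where
  toFun _ := 0
  mono _ _ _ := le_rfl
  sup t := by
    obtain ⟨a, -, -, h⟩ := exists_seq (M := M) t
    rw [h _ (fun _ _ _ => le_rfl)]
    simp
  prec _ _ _ := QSemigroup.zero_prec 0

/-- Pointwise addition of paths. -/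
def add (f g : TauPath M) : TauPath M where
  toFun t := f.toFun t + g.toFun t
  mono _ _ h := add_le_add (f.mono h) (g.mono h)
  sup t := by
    obtain ⟨a, ha, -, h⟩ := exists_seq (M := M) t
    rw [h (fun t => f.toFun t + g.toFun t) (fun _ _ h => add_le_add (f.mono h) (g.mono h))]
    exact QSemigroup.o4 _ _ (f.mono.comp ha) (g.mono.comp ha) _ _
      ((h _ f.mono _).1 (f.sup t)) ((h _ g.mono _).1 (g.sup t))
  prec s t h := QSemigroup.prec_add _ _ _ _ (f.prec s t h) (g.prec s t h)

/-- The preorder on paths. -/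
def Below (f g : TauPath M) : Prop :=
  ∀ t : Set.Iic (0 : ℝ), (t : ℝ) < 0 →
    ∃ t' : Set.Iic (0 : ℝ), (t' : ℝ) < 0 ∧ QSemigroup.prec (f.toFun t) (g.toFun t')

theorem Below.refl (f : TauPath M) : f.Below f := fun t ht =>
  ⟨⟨(t : ℝ) / 2, show (t : ℝ) / 2 ≤ 0 by linarith⟩, show (t : ℝ) / 2 < 0 by linarith,
    f.prec _ _ (show (t : ℝ) < (t : ℝ) / 2 by linarith)⟩

theorem Below.trans {f g h : TauPath M} (h₁ : f.Below g) (h₂ : g.Below h) : f.Below h := by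
  intro t ht
  obtain ⟨s, hs, hfg⟩ := h₁ t ht
  obtain ⟨r, hr, hgh⟩ := h₂ s hs
  exact ⟨r, hr, QSemigroup.prec_mono _ _ _ _ (QSemigroup.le_of_prec _ _ hfg) hgh le_rfl⟩

theorem Below.add {f f' g g' : TauPath M} (h₁ : f.Below f') (h₂ : g.Below g') :
    (f.add g).Below (f'.add g') := by
  intro t ht
  obtain ⟨s, hs, hf⟩ := h₁ t ht
  obtain ⟨r, hr, hg⟩ := h₂ t ht
  refine ⟨max s r, max_lt hs hr, QSemigroup.prec_add _ _ _ _ ?_ ?_⟩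
  · exact QSemigroup.prec_mono _ _ _ _ le_rfl hf (f'.mono (le_max_left s r))
  · exact QSemigroup.prec_mono _ _ _ _ le_rfl hg (g'.mono (le_max_right s r))

/-- The endpoint of a path. -/
def endpoint (f : TauPath M) : M := f.toFun ⟨0, Set.mem_Iic.2 le_rfl⟩

theorem Below.endpoint_le {f g : TauPath M} (h : f.Below g) : f.endpoint ≤ g.endpoint := by
  refine (f.sup ⟨0, Set.mem_Iic.2 le_rfl⟩).2 ?_
  rintro _ ⟨t, ht, rfl⟩
  obtain ⟨s, hs, hfg⟩ := h t ht
  exact (QSemigroup.le_of_prec _ _ hfg).trans (g.mono (show s ≤ ⟨0, Set.mem_Iic.2 le_rfl⟩ from hs.le))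

/-- Equivalence of paths. -/
def pathSetoid (M : Type u) [PosOrdMonoid M] [QSemigroup M] : Setoid (TauPath M) where
  r f g := f.Below g ∧ g.Below f
  iseqv := ⟨fun f => ⟨.refl f, .refl f⟩, fun h => ⟨h.2, h.1⟩,
    fun h₁ h₂ => ⟨h₁.1.trans h₂.1, h₂.2.trans h₁.2⟩⟩

end TauPath

/-- The τ-construction `τ(M)`: paths modulo equivalence. -/
def Tau (M : Type u) [PosOrdMonoid M] [QSemigroup M] : Type u :=
  Quotient (TauPath.pathSetoid M)

namespace Tau

variable {M : Type u} [PosOrdMonoid M] [QSemigroup M]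

/-- The class of a path. -/
def mk (f : TauPath M) : Tau M := Quotient.mk (TauPath.pathSetoid M) f

instance : Zero (Tau M) := ⟨mk TauPath.zero⟩

instance : Add (Tau M) :=
  ⟨Quotient.map₂ TauPath.add fun _ _ h₁ _ _ h₂ => ⟨h₁.1.add h₂.1, h₁.2.add h₂.2⟩⟩

instance : LE (Tau M) :=
  ⟨Quotient.lift₂ TauPath.Below fun _ _ _ _ h₁ h₂ =>
    propext ⟨fun h => (h₁.2.trans h).trans h₂.1, fun h => (h₁.1.trans h).trans h₂.2⟩⟩

theorem mk_le_mk {f g : TauPath M} : mk f ≤ mk g ↔ f.Below g := Iff.rfl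

theorem mk_add_mk (f g : TauPath M) : mk f + mk g = mk (f.add g) := rfl

theorem mk_congr {f g : TauPath M} (h : f.toFun = g.toFun) : mk f = mk g := by
  cases f; cases g; cases h; rfl

instance : PosOrdMonoid (Tau M) where
  add_assoc := by
    rintro ⟨f⟩ ⟨g⟩ ⟨h⟩
    exact mk_congr (funext fun t => add_assoc _ _ _)
  zero_add := by
    rintro ⟨f⟩
    exact mk_congr (funext fun t => zero_add _)
  add_zero := by
    rintro ⟨f⟩
    exact mk_congr (funext fun t => add_zero _)
  add_comm := by
    rintro ⟨f⟩ ⟨g⟩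
    exact mk_congr (funext fun t => add_comm _ _)
  nsmul := nsmulRec
  le_refl := by
    rintro ⟨f⟩
    exact TauPath.Below.refl f
  le_trans := by
    rintro ⟨f⟩ ⟨g⟩ ⟨h⟩ h₁ h₂
    exact TauPath.Below.trans h₁ h₂
  le_antisymm := by
    rintro ⟨f⟩ ⟨g⟩ h₁ h₂
    exact Quotient.sound ⟨h₁, h₂⟩
  add_le_add_left := by
    rintro ⟨f⟩ ⟨g⟩ h ⟨k⟩
    exact TauPath.Below.add h (TauPath.Below.refl k)
  zero_le_all := by
    rintro ⟨f⟩ t ht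
    exact ⟨t, ht, QSemigroup.zero_prec _⟩

/-- The endpoint map `τ(M) → M`. -/
def endpoint (M : Type u) [PosOrdMonoid M] [QSemigroup M] : Tau M →+o M where
  toFun := Quotient.lift TauPath.endpoint fun _ _ h => le_antisymm h.1.endpoint_le h.2.endpoint_le
  map_zero' := rfl
  map_add' := by
    rintro ⟨f⟩ ⟨g⟩
    rfl
  monotone' := by
    rintro ⟨f⟩ ⟨g⟩ h
    exact TauPath.Below.endpoint_le h

end Tau

/-! ### Limits of positively ordered monoids -/

instance {ι : Type u} (M : ι → Type u) [∀ i, PosOrdMonoid (M i)] : PosOrdMonoid (∀ i, M i) where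
  zero_le_all x := fun i => PosOrdMonoid.zero_le_all (x i)

instance {M : Type u} [PosOrdMonoid M] (N : AddSubmonoid M) : PosOrdMonoid N where
  zero_le_all x := PosOrdMonoid.zero_le_all (x : M)

section Limit

variable {J : Type u} [SmallCategory J]

/-- The compatible families in a diagram of Cu-semigroups, as a submonoid of the product. -/
def compatibleFamilies (F : J ⥤ CuCat.{u}) : AddSubmonoid (∀ j, (F.obj j).carrier) where
  carrier := {s | ∀ ⦃i j : J⦄ (f : i ⟶ j), CuCat.Hom.hom (F.map f) (s i) = s j}
  zero_mem' _ _ f := map_zero (CuCat.Hom.hom (F.map f))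
  add_mem' := by
    intro s t hs ht i j f
    exact (map_add (CuCat.Hom.hom (F.map f)) _ _).trans (congrArg₂ (· + ·) (hs f) (ht f))

/-- The limit in positively ordered monoids of a diagram of Cu-semigroups, with componentwise
addition and order. -/
abbrev PomLimit (F : J ⥤ CuCat.{u}) : Type u := compatibleFamilies F

/-- The projections of `PomLimit F`. -/
def pomProj (F : J ⥤ CuCat.{u}) (j : J) : PomLimit F →+o (F.obj j).carrier where
  toFun s := s.1 j
  map_zero' := rfl
  map_add' _ _ := rfl
  monotone' _ _ h := h j

theorem PomLimit.isLUB_of_forall (F : J ⥤ CuCat.{u}) (s : ℕ → PomLimit F) (z : PomLimit F)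
    (h : ∀ j, IsLUB (Set.range fun n => (s n).1 j) (z.1 j)) : IsLUB (Set.range s) z := by
  constructor
  · rintro _ ⟨n, rfl⟩ j
    exact (h j).1 ⟨n, rfl⟩
  · intro w hw j
    refine (h j).2 ?_
    rintro _ ⟨n, rfl⟩
    exact hw ⟨n, rfl⟩ j

theorem PomLimit.exists_sup (F : J ⥤ CuCat.{u}) (s : ℕ → PomLimit F) (hs : Monotone s) :
    ∃ z : PomLimit F, ∀ j, IsLUB (Set.range fun n => (s n).1 j) (z.1 j) := by
  have hm : ∀ j, Monotone fun n => (s n).1 j := fun j _ _ h => hs h j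
  choose z hz using fun j => (F.obj j).isCu.o1 _ (hm j)
  refine ⟨⟨z, fun i j f => ?_⟩, hz⟩
  have h := (F.map f).isCu.map_sup _ (hm i) _ (hz i)
  have e : (fun n => CuCat.Hom.hom (F.map f) ((s n).1 i)) = fun n => (s n).1 j :=
    funext fun n => (s n).2 f
  rw [e] at h
  exact h.unique (hz j)

theorem PomLimit.isLUB_apply (F : J ⥤ CuCat.{u}) (s : ℕ → PomLimit F) (hs : Monotone s)
    (z : PomLimit F) (h : IsLUB (Set.range s) z) (j : J) :
    IsLUB (Set.range fun n => (s n).1 j) (z.1 j) := by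
  obtain ⟨w, hw⟩ := PomLimit.exists_sup F s hs
  rw [h.unique (PomLimit.isLUB_of_forall F s w hw)]
  exact hw j

theorem WayBelow.le {M : Type u} [PosOrdMonoid M] {x y : M} (h : WayBelow x y) : x ≤ y := by
  obtain ⟨_, hk⟩ := h (fun _ => y) (fun _ _ _ => le_rfl) y (by simp) le_rfl
  exact hk

/-- `PomLimit F` with the componentwise way-below relation is a Q-semigroup. -/
instance (F : J ⥤ CuCat.{u}) : QSemigroup (PomLimit F) where
  prec s t := ∀ j, WayBelow (s.1 j) (t.1 j)
  o1 s hs := by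
    obtain ⟨z, hz⟩ := PomLimit.exists_sup F s hs
    exact ⟨z, PomLimit.isLUB_of_forall F s z hz⟩
  o4 s t hs ht x y hx hy := PomLimit.isLUB_of_forall F _ _ fun j =>
    (F.obj j).isCu.o4 (fun n => (s n).1 j) (fun n => (t n).1 j) (fun _ _ h => hs h j)
      (fun _ _ h => ht h j) _ _ (PomLimit.isLUB_apply F s hs x hx j)
      (PomLimit.isLUB_apply F t ht y hy j)
  le_of_prec _ _ h j := (h j).le
  prec_mono _ _ _ _ h₁ h h₂ j := fun s hs z hz hle => by
    obtain ⟨k, hk⟩ := h j s hs z hz ((h₂ j).trans hle)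
    exact ⟨k, (h₁ j).trans hk⟩
  zero_prec _ _ := fun _ _ _ _ _ => ⟨0, PosOrdMonoid.zero_le_all _⟩
  prec_add _ _ _ _ h₁ h₂ j := (F.obj j).isCu.o3 _ _ _ _ (h₁ j) (h₂ j)

/-! ### The limit of a diagram of Cu-semigroups -/

/-- The map `ψ_j : τ(PomLimit F) → F(j)`, `[f] ↦ f(0)_j`.  This is `τ(π_j)` followed by the
identification of `τ(F(j))` with `F(j)` through the endpoint map. -/
def tauProj (F : J ⥤ CuCat.{u}) (j : J) : Tau (PomLimit F) →+o (F.obj j).carrier :=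
  (pomProj F j).comp (Tau.endpoint (PomLimit F))

theorem tauProj_compat (F : J ⥤ CuCat.{u}) {i j : J} (f : i ⟶ j) (x : Tau (PomLimit F)) :
    CuCat.Hom.hom (F.map f) (tauProj F i x) = tauProj F j x :=
  (Tau.endpoint (PomLimit F) x).2 f

/-- The cone `(τ(PomLimit F), (ψ_j)_j)` over a diagram `F` of Cu-semigroups. -/
def tauCone (F : J ⥤ CuCat.{u}) (hCu : IsCuSemigroup (Tau (PomLimit F)))
    (hψ : ∀ j, IsCuMorphism (tauProj F j)) : Cone F where
  pt := ⟨Tau (PomLimit F), hCu⟩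
  π :=
    { app := fun j => ⟨tauProj F j, hψ j⟩
      naturality := fun _ _ f =>
        CuCat.Hom.ext (OrderAddMonoidHom.ext fun x => (tauProj_compat F f x).symm) }

/-! ### The limit of a diagram of scaled Cu-semigroups -/

/-- The set `Σ₀` of compatible families whose entries all lie in the scales. -/
def limitScaleZero (F : J ⥤ CuSc.{u}) : Set (PomLimit (F ⋙ forgetScale)) :=
  {s | ∀ j, s.1 j ∈ (F.obj j).scale}

/-- The set `Σ` of classes of paths `f` with `f(t) ∈ Σ₀` for all `t < 0`. -/
def tauScale (F : J ⥤ CuSc.{u}) : Set (Tau (PomLimit (F ⋙ forgetScale))) :=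
  {x | ∃ f : TauPath (PomLimit (F ⋙ forgetScale)), x = Tau.mk f ∧
    ∀ t : Set.Iic (0 : ℝ), (t : ℝ) < 0 → f.toFun t ∈ limitScaleZero F}

/-- The ideal of `τ(PomLimit F)` that is generated by `Σ`. -/
abbrev limitIdeal (F : J ⥤ CuSc.{u}) : AddSubmonoid (Tau (PomLimit (F ⋙ forgetScale))) :=
  idealGen (tauScale F)

/-- The set `Σ` as a subset of the ideal that it generates. -/
def limitScale (F : J ⥤ CuSc.{u}) : Set (limitIdeal F) :=
  {x | (x : Tau (PomLimit (F ⋙ forgetScale))) ∈ tauScale F}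

/-- The restriction of `ψ_j` to the ideal generated by `Σ`. -/
def limitProj (F : J ⥤ CuSc.{u}) (j : J) : limitIdeal F →+o (F.obj j).toCu.carrier where
  toFun x := tauProj (F ⋙ forgetScale) j x.1
  map_zero' := map_zero (tauProj (F ⋙ forgetScale) j)
  map_add' x y := map_add (tauProj (F ⋙ forgetScale) j) x.1 y.1
  monotone' _ _ h := (tauProj (F ⋙ forgetScale) j).monotone' h

/-- The cone `((⟨Σ⟩, Σ), (ψ_j)_j)` over a diagram `F` of scaled Cu-semigroups. -/
def limitCone (F : J ⥤ CuSc.{u}) (hCu : IsCuSemigroup (limitIdeal F))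
    (hsc : IsScale (limitScale F)) (hψ : ∀ j, IsCuMorphism (limitProj F j))
    (hmap : ∀ j, ∀ x ∈ limitScale F, limitProj F j x ∈ (F.obj j).scale) : Cone F where
  pt := ⟨⟨limitIdeal F, hCu⟩, limitScale F, hsc⟩
  π :=
    { app := fun j => ⟨⟨limitProj F j, hψ j⟩, hmap j⟩
      naturality := fun _ _ f => CuSc.Hom.ext (CuCat.Hom.ext (OrderAddMonoidHom.ext fun x =>
        (tauProj_compat (F ⋙ forgetScale) f x.1).symm)) }

/-! ### The colimit of a diagram of scaled Cu-semigroups -/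

/-- The union of the images of the scales in a cocone of Cu-semigroups. -/
def imageScales (F : J ⥤ CuSc.{u}) (c : Cocone (F ⋙ forgetScale)) : Set c.pt.carrier :=
  ⋃ j, CuCat.Hom.hom (c.ι.app j) '' (F.obj j).scale

/-- The smallest subset that contains the images of the scales, is downward hereditary and is closed
under suprema of increasing sequences. -/
def generatedScale (F : J ⥤ CuSc.{u}) (c : Cocone (F ⋙ forgetScale)) : Set c.pt.carrier :=
  ⋂₀ {A | IsLowerSet A ∧ SeqSupClosed A ∧ imageScales F c ⊆ A}

/-- The cocone of scaled Cu-semigroups obtained from a cocone of Cu-semigroups through the generated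
scale. -/
def scaledCocone (F : J ⥤ CuSc.{u}) (c : Cocone (F ⋙ forgetScale))
    (hsc : IsScale (generatedScale F c)) : Cocone F where
  pt := ⟨c.pt, generatedScale F c, hsc⟩
  ι :=
    { app := fun j => ⟨c.ι.app j, fun x hx =>
        Set.mem_sInter.2 fun _ hA => hA.2.2 (Set.mem_iUnion.2 ⟨j, x, hx, rfl⟩)⟩
      naturality := fun _ _ f => CuSc.Hom.ext (c.ι.naturality f) }

end Limit

end Cuntz

/-! Limits. Componentwise suprema give (O1) and (O4) for the compatible families, but such a family
need not be a supremum of a sequence increasing for the componentwise way-below relation, so (O2)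
may fail. The τ-construction repairs this by recording an approximation along with the element: a
path carries its own approximants, namely its translates. An increasing sequence of paths has a
diagonal path as supremum, attained level by level (`TauPath.exists_sup`); hence way-below in τ is
controlled by a single negative time of a path, and (O1)-(O4) follow (`Tau.isCuSemigroup`).

Universality rests on interpolation: each element of a Cu-semigroup has a real-indexed way-below
increasing approximation (`IsCuSemigroup.exists_chain`). Its image under a map that preserves
suprema and turns `≪` into `≺` becomes a path after left regularization, which lifts the map to τ
(`Tau.exists_lift`). Cu-morphisms into τ are determined by endpoints (`Tau.hom_ext`). With scales, a
cone sends scale elements to paths with endpoint in `limitScaleZero`, hence into Σ; since scales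
generate, the whole cone lands in the ideal generated by Σ.

Colimits. As Cu has limits, the adjoint functor theorem applied to the constant-diagram functor
leaves only a solution set. Every cocone factors through the suprema of way-below increasing
sequences of finite sums of its values, a Cu-semigroup whose cardinality is bounded by the diagram
(`exists_small_factor`). For scales, preimages of scales under Cu-morphisms are downward hereditary
and closed under suprema, so the generated scale maps where it must; it generates because a colimit
has no proper ideal containing all the images (`isCuIdeal_eq_top`). -/

namespace Cuntz

/-! ### Way-below calculus and order embeddings of Cu-semigroups -/

section Basic

variable {M N : Type u} [PosOrdMonoid M] [PosOrdMonoid N]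

theorem WayBelow.mono {w x y z : M} (h₁ : w ≤ x) (h : WayBelow x y) (h₂ : y ≤ z) :
    WayBelow w z := fun s hs v hv hle => by
  obtain ⟨k, hk⟩ := h s hs v hv (h₂.trans hle)
  exact ⟨k, h₁.trans hk⟩

theorem zero_wayBelow (x : M) : WayBelow 0 x := fun _ _ _ _ _ => ⟨0, PosOrdMonoid.zero_le_all _⟩

theorem monotone_of_wayBelow {s : ℕ → M} (hs : ∀ n, WayBelow (s n) (s (n + 1))) : Monotone s :=
  monotone_nat_of_le_succ fun n => (hs n).le

theorem IsCuSemigroup.exists_between (hM : IsCuSemigroup M) {x z : M} (h : WayBelow x z) :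
    ∃ y, WayBelow x y ∧ WayBelow y z := by
  obtain ⟨s, hs, hz⟩ := hM.o2 z
  obtain ⟨k, hk⟩ := h s (monotone_of_wayBelow hs) z hz le_rfl
  exact ⟨s (k + 1), (hs k).mono hk le_rfl, (hs (k + 1)).mono le_rfl (hz.1 ⟨k + 2, rfl⟩)⟩

/-- Elements of a Cu-semigroup are suprema of increasing sequences of way-below elements. -/
theorem IsCuSemigroup.exists_approx (hM : IsCuSemigroup M) (x : M) :
    ∃ s : ℕ → M, Monotone s ∧ (∀ n, WayBelow (s n) x) ∧ IsLUB (Set.range s) x := by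
  obtain ⟨s, hs, hx⟩ := hM.o2 x
  exact ⟨s, monotone_of_wayBelow hs, fun n => (hs n).mono le_rfl (hx.1 ⟨n + 1, rfl⟩), hx⟩

/-- A way-below element of a sum lies below a sum of way-below elements. -/
theorem IsCuSemigroup.exists_add (hM : IsCuSemigroup M) {x y z : M} (h : WayBelow z (x + y)) :
    ∃ x' y', WayBelow x' x ∧ WayBelow y' y ∧ z ≤ x' + y' := by
  obtain ⟨s, hs, hsx, hx⟩ := hM.exists_approx x
  obtain ⟨t, ht, hty, hy⟩ := hM.exists_approx y
  obtain ⟨k, hk⟩ := h _ (fun _ _ hab => add_le_add (hs hab) (ht hab)) _ (hM.o4 s t hs ht x y hx hy)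
    le_rfl
  exact ⟨s k, t k, hsx k, hty k, hk⟩

/-- Submonoid-like embeddings that are closed under suprema of increasing sequences and have enough
way-below sequences yield Cu-semigroups. -/
theorem isCuSemigroup_of_embedding (hN : IsCuSemigroup N) (ι : M →+o N)
    (hι : ∀ x y, ι x ≤ ι y → x ≤ y) (hsup : SeqSupClosed (Set.range ι))
    (happ : ∀ x, ∃ s : ℕ → M, (∀ n, WayBelow (ι (s n)) (ι (s (n + 1)))) ∧
      IsLUB (Set.range fun n => ι (s n)) (ι x)) :
    IsCuSemigroup M ∧ IsCuMorphism ι ∧ ∀ x y, WayBelow (ι x) (ι y) → WayBelow x y := by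
  have refl_lub : ∀ (s : ℕ → M) (z : M), IsLUB (Set.range fun n => ι (s n)) (ι z) →
      IsLUB (Set.range s) z := by
    intro s z h
    refine ⟨?_, fun w hw => hι _ _ (h.2 ?_)⟩
    · rintro _ ⟨n, rfl⟩
      exact hι _ _ (h.1 ⟨n, rfl⟩)
    · rintro _ ⟨n, rfl⟩
      exact ι.monotone' (hw ⟨n, rfl⟩)
  have ex_sup : ∀ s : ℕ → M, Monotone s → ∃ z, IsLUB (Set.range fun n => ι (s n)) (ι z) := by
    intro s hs
    have hm : Monotone fun n => ι (s n) := fun _ _ h => ι.monotone' (hs h)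
    obtain ⟨w, hw⟩ := hN.o1 _ hm
    obtain ⟨z, rfl⟩ := hsup _ hm (fun n => ⟨_, rfl⟩) w hw
    exact ⟨z, hw⟩
  have pres : PreservesSeqSup ι := by
    intro s hs z hz
    obtain ⟨w, hw⟩ := ex_sup s hs
    rwa [hz.unique (refl_lub s w hw)]
  have refl_wb : ∀ x y, WayBelow (ι x) (ι y) → WayBelow x y := by
    intro x y h s hs z hz hle
    obtain ⟨k, hk⟩ := h _ (fun _ _ h => ι.monotone' (hs h)) _ (pres s hs z hz) (ι.monotone' hle)
    exact ⟨k, hι _ _ hk⟩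
  -- The approximants of `y` supplied by `happ` are way below one another already in `N`, and `x`
  -- lies under one of them.
  have map_wb : ∀ x y, WayBelow x y → WayBelow (ι x) (ι y) := by
    intro x y h
    obtain ⟨s, hs, hy⟩ := happ y
    obtain ⟨k, hk⟩ := h s (monotone_of_wayBelow fun n => refl_wb _ _ (hs n)) y (refl_lub _ _ hy)
      le_rfl
    exact (hs k).mono (ι.monotone' hk) (hy.1 ⟨k + 1, rfl⟩)
  refine ⟨⟨?_, ?_, ?_, ?_⟩, ⟨map_wb, pres⟩, refl_wb⟩
  · intro s hs
    obtain ⟨z, hz⟩ := ex_sup s hs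
    exact ⟨z, refl_lub s z hz⟩
  · intro x
    obtain ⟨s, hs, hx⟩ := happ x
    exact ⟨s, fun n => refl_wb _ _ (hs n), refl_lub _ _ hx⟩
  · intro x' x y' y hx hy
    apply refl_wb
    rw [map_add, map_add]
    exact hN.o3 _ _ _ _ (map_wb _ _ hx) (map_wb _ _ hy)
  · intro s t hs ht x y hx hy
    apply refl_lub
    simp only [map_add]
    exact hN.o4 _ _ (fun _ _ h => ι.monotone' (hs h)) (fun _ _ h => ι.monotone' (ht h)) _ _
      (pres s hs x hx) (pres t ht y hy)

/-! ### Ideals -/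

/-- The inclusion of a submonoid. -/
def submonoidIncl (I : AddSubmonoid M) : I →+o M where
  toFun x := x
  map_zero' := rfl
  map_add' _ _ := rfl
  monotone' _ _ h := h

/-- The corestriction of a morphism to a submonoid. -/
def corestrict (f : N →+o M) (I : AddSubmonoid M) (h : ∀ x, f x ∈ I) : N →+o I where
  toFun x := ⟨f x, h x⟩
  map_zero' := Subtype.ext (map_zero f)
  map_add' x y := Subtype.ext (map_add f x y)
  monotone' _ _ h := f.monotone' h

/-- Downward heredity keeps the ambient approximating sequence of a member inside the ideal, so the
embedding criterion applies. -/
theorem IsCuIdeal.embedding (hM : IsCuSemigroup M) {I : AddSubmonoid M} (hI : IsCuIdeal I) :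
    IsCuSemigroup I ∧ IsCuMorphism (submonoidIncl I) ∧
      ∀ x y : I, WayBelow (x : M) (y : M) → WayBelow x y := by
  refine isCuSemigroup_of_embedding hM (submonoidIncl I) (fun _ _ h => h) ?_ ?_
  · intro s hs hmem z hz
    have hmem' : ∀ n, s n ∈ I := fun n => by
      obtain ⟨y, hy⟩ := hmem n
      exact hy ▸ y.2
    exact ⟨⟨z, hI.2 s hs hmem' z hz⟩, rfl⟩
  · rintro ⟨x, hx⟩
    obtain ⟨s, hs, hsx⟩ := hM.o2 x
    exact ⟨fun n => ⟨s n, hI.1 (hsx.1 ⟨n, rfl⟩) hx⟩, hs, hsx⟩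

theorem IsCuIdeal.corestrict_isCu (hM : IsCuSemigroup M) {I : AddSubmonoid M} (hI : IsCuIdeal I)
    {f : N →+o M} (hf : IsCuMorphism f) (h : ∀ x, f x ∈ I) : IsCuMorphism (corestrict f I h) := by
  obtain ⟨-, -, hr⟩ := hI.embedding hM
  refine ⟨fun x y hxy => hr _ _ (hf.map_wayBelow x y hxy), fun s hs z hz => ?_⟩
  have := hf.map_sup s hs z hz
  refine ⟨?_, fun w hw => this.2 ?_⟩
  · rintro _ ⟨n, rfl⟩
    exact this.1 ⟨n, rfl⟩
  · rintro _ ⟨n, rfl⟩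
    exact hw ⟨n, rfl⟩

theorem subset_idealGen (A : Set M) : A ⊆ idealGen A := fun x hx => by
  rw [SetLike.mem_coe, idealGen, AddSubmonoid.mem_sInf]
  exact fun I hI => hI.2 hx

theorem idealGen_le {A : Set M} {I : AddSubmonoid M} (hI : IsCuIdeal I) (h : A ⊆ I) :
    idealGen A ≤ I := sInf_le ⟨hI, h⟩

theorem isCuIdeal_idealGen (A : Set M) : IsCuIdeal (idealGen A) := by
  constructor
  · intro x y hyx hx
    rw [SetLike.mem_coe, idealGen, AddSubmonoid.mem_sInf] at hx ⊢
    exact fun I hI => hI.1.1 hyx (hx I hI)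
  · intro s hs hmem z hz
    rw [SetLike.mem_coe, idealGen, AddSubmonoid.mem_sInf]
    refine fun I hI => hI.1.2 s hs (fun n => ?_) z hz
    have := hmem n
    rw [SetLike.mem_coe, idealGen, AddSubmonoid.mem_sInf] at this
    exact this I hI

/-- The preimage of an ideal. -/
def idealPreimage (f : N →+o M) (I : AddSubmonoid M) : AddSubmonoid N where
  carrier := {x | f x ∈ I}
  zero_mem' := by simp
  add_mem' := by
    intro x y hx hy
    change f (x + y) ∈ I
    rw [map_add]
    exact I.add_mem hx hy

theorem IsCuIdeal.preimage {f : N →+o M} (hf : PreservesSeqSup f) {I : AddSubmonoid M}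
    (hI : IsCuIdeal I) : IsCuIdeal (idealPreimage f I) :=
  ⟨fun _ _ hyx hx => hI.1 (f.monotone' hyx) hx, fun s hs hmem z hz =>
    hI.2 (fun n => f (s n)) (fun _ _ h => f.monotone' (hs h)) hmem _ (hf s hs z hz)⟩

/-- A map that sends a scale into an ideal has range in that ideal. -/
theorem IsScale.forall_mem {A : Set N} (hA : IsScale A) {f : N →+o M} (hf : PreservesSeqSup f)
    {I : AddSubmonoid M} (hI : IsCuIdeal I) (h : ∀ x ∈ A, f x ∈ I) (x : N) : f x ∈ I := by
  have := idealGen_le (hI.preimage hf) (A := A) h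
  rw [hA.generates] at this
  exact this (AddSubmonoid.mem_top x)

end Basic

/-! ### Real-indexed way-below chains by dyadic interpolation -/

section Chain

/-- Iterated dyadic refinement of a sequence. -/
def dyadic {M : Type u} (mid : M → M → M) (s : ℕ → M) : ℕ → ℕ → M
  | 0, k => s k
  | n + 1, k => if k % 2 = 0 then dyadic mid s n (k / 2)
      else mid (dyadic mid s n (k / 2)) (dyadic mid s n (k / 2 + 1))

theorem dyadic_double {M : Type u} (mid : M → M → M) (s : ℕ → M) (n p k : ℕ) :
    dyadic mid s (n + p) (2 ^ p * k) = dyadic mid s n k := by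
  induction p with
  | zero => simp
  | succ p ih =>
    rw [← ih, ← add_assoc, dyadic, show 2 ^ (p + 1) * k = 2 * (2 ^ p * k) by rw [pow_succ]; ring,
      if_pos (by omega), Nat.mul_div_cancel_left _ two_pos]

variable {M : Type u} [PosOrdMonoid M]

theorem dyadic_wayBelow_succ {mid : M → M → M}
    (hmid : ∀ a b, WayBelow a b → WayBelow a (mid a b) ∧ WayBelow (mid a b) b) {s : ℕ → M}
    (hs : ∀ n, WayBelow (s n) (s (n + 1))) (n k : ℕ) :
    WayBelow (dyadic mid s n k) (dyadic mid s n (k + 1)) := by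
  induction n generalizing k with
  | zero => exact hs k
  | succ n ih =>
    rw [dyadic, dyadic]
    rcases Nat.even_or_odd' k with ⟨l, rfl | rfl⟩
    · rw [if_pos (by omega), if_neg (by omega), show (2 * l + 1) / 2 = l by omega,
        show 2 * l / 2 = l by omega]
      exact (hmid _ _ (ih l)).1
    · rw [if_neg (by omega), if_pos (by omega), show (2 * l + 1) / 2 = l by omega,
        show (2 * l + 1 + 1) / 2 = l + 1 by omega]
      exact (hmid _ _ (ih l)).2

/-- Every element of a Cu-semigroup is the supremum of a way-below increasing family that is
indexed by the nonnegative reals. -/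
theorem IsCuSemigroup.exists_chain_nonneg (hM : IsCuSemigroup M) (x : M) :
    ∃ h : ℝ → M, (∀ u v, 0 ≤ u → u < v → WayBelow (h u) (h v)) ∧ IsLUB (h '' Set.Ici 0) x := by
  obtain ⟨s, hs, hx⟩ := hM.o2 x
  have : ∀ a b : M, ∃ c, WayBelow a b → WayBelow a c ∧ WayBelow c b := by
    intro a b
    by_cases h : WayBelow a b
    · obtain ⟨c, hc⟩ := hM.exists_between h
      exact ⟨c, fun _ => hc⟩
    -- An arbitrary value, so that `mid` becomes a total function.
    · exact ⟨0, fun h' => absurd h' h⟩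
  choose mid hmid using this
  set D := dyadic mid s with hD
  have hD1 : ∀ n k, WayBelow (D n k) (D n (k + 1)) := dyadic_wayBelow_succ hmid hs
  have hDm : ∀ n, Monotone (D n) := fun n => monotone_of_wayBelow (hD1 n)
  have hD2 : ∀ n p k, D (n + p) (2 ^ p * k) = D n k := dyadic_double mid s
  have hm : ∀ u : ℝ, 0 ≤ u → Monotone fun n => D n ⌊2 ^ n * u⌋₊ := by
    intro u hu
    refine monotone_nat_of_le_succ fun n => ?_
    rw [← hD2 n 1]
    refine hDm _ (Nat.le_floor ?_)
    push_cast
    have := Nat.floor_le (show 0 ≤ 2 ^ n * u by positivity)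
    rw [pow_succ]
    linarith
  have hex : ∀ u : ℝ, ∃ z, 0 ≤ u → IsLUB (Set.range fun n => D n ⌊2 ^ n * u⌋₊) z := by
    intro u
    by_cases hu : 0 ≤ u
    · obtain ⟨z, hz⟩ := hM.o1 _ (hm u hu)
      exact ⟨z, fun _ => hz⟩
    · exact ⟨0, fun h => absurd h hu⟩
  choose h hh using hex
  have hle : ∀ u, 0 ≤ u → ∀ n, h u ≤ D n (⌊2 ^ n * u⌋₊ + 1) := by
    intro u hu n
    refine (hh u hu).2 ?_
    rintro _ ⟨m, rfl⟩
    -- Compare on a common refinement `n + p` of both levels, where `2 ^ (n + p) * u ≤ 2 ^ p * (⌊2 ^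
    -- n * u⌋₊ + 1)`.
    refine (hm u hu (le_max_left m n)).trans ?_
    obtain ⟨p, hp⟩ := Nat.exists_eq_add_of_le (le_max_right m n)
    rw [hp, ← hD2 n p]
    refine hDm _ (Nat.cast_le (α := ℝ).1 ?_)
    refine (Nat.floor_le (by positivity)).trans ?_
    push_cast
    rw [pow_add, mul_comm (2 ^ n : ℝ), mul_assoc]
    exact mul_le_mul_of_nonneg_left (Nat.lt_floor_add_one _).le (by positivity)
  refine ⟨h, ?_, ?_, ?_⟩
  · intro u v hu huv
    -- A gap of more than two grid steps is needed: one step to lie above `h u`, and a second,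
    -- way-below step that ends under `h v`.
    obtain ⟨n, hn⟩ := pow_unbounded_of_one_lt (2 / (v - u)) (one_lt_two (α := ℝ))
    rw [div_lt_iff₀ (sub_pos.2 huv)] at hn
    refine (hD1 n _).mono (hle u hu n) ((hDm n ?_).trans ((hh v (hu.trans huv.le)).1 ⟨n, rfl⟩))
    refine Nat.le_floor ?_
    push_cast
    have := Nat.floor_le (show 0 ≤ 2 ^ n * u by positivity)
    linarith
  · rintro _ ⟨u, hu, rfl⟩
    refine (hle u hu 0).trans (hx.1 ⟨_, rfl⟩)
  · intro w hw
    refine hx.2 ?_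
    rintro _ ⟨k, rfl⟩
    refine le_trans ?_ (hw ⟨(k : ℝ), Set.mem_Ici.2 (Nat.cast_nonneg k), rfl⟩)
    have := (hh k (Nat.cast_nonneg k)).1 ⟨0, rfl⟩
    simpa [hD, dyadic] using this

theorem neg_inv_lt_neg_inv {s t : ℝ} (h : s < t) (ht : t < 0) : -s⁻¹ < -t⁻¹ :=
  neg_lt_neg ((inv_lt_inv_of_neg ht (h.trans ht)).2 h)

/-- Every element of a Cu-semigroup is the endpoint of a way-below increasing family that is
indexed by the negative reals. -/
theorem IsCuSemigroup.exists_chain (hM : IsCuSemigroup M) (x : M) :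
    ∃ g : ℝ → M, (∀ s t, s < t → t < 0 → WayBelow (g s) (g t)) ∧ IsLUB (g '' Set.Iio 0) x := by
  obtain ⟨h, hlt, hx⟩ := hM.exists_chain_nonneg x
  -- The map `t ↦ -t⁻¹` is an increasing bijection from the negative to the positive reals. It
  -- misses `u = 0`, so cofinality is checked at `u + 1`.
  refine ⟨fun t => h (-t⁻¹), fun s t hst ht => hlt _ _ ?_ (neg_inv_lt_neg_inv hst ht), ?_, ?_⟩
  · exact neg_nonneg.2 (inv_nonpos.2 (hst.trans ht).le)
  · rintro _ ⟨t, ht, rfl⟩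
    exact hx.1 ⟨_, Set.mem_Ici.2 (neg_nonneg.2 (inv_nonpos.2 (le_of_lt ht))), rfl⟩
  · intro w hw
    refine hx.2 ?_
    rintro _ ⟨u, hu, rfl⟩
    have hu' : (0 : ℝ) < u + 1 := add_pos_of_nonneg_of_pos hu one_pos
    refine (hlt u (u + 1) hu (lt_add_one u)).le.trans (hw ⟨-(u + 1)⁻¹, ?_, ?_⟩)
    · exact neg_lt_zero.2 (inv_pos.2 hu')
    · simp only [inv_neg, inv_inv, neg_neg]

end Chain

/-- Suprema of monotone functions on `(-∞, t)` are suprema along a sequence. -/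
theorem isLUB_image_Iio_iff {M : Type u} [PartialOrder M] {g : ℝ → M} {t : ℝ}
    (hg : ∀ s s', s ≤ s' → s' < t → g s ≤ g s') (z : M) :
    IsLUB (g '' Set.Iio t) z ↔ IsLUB (Set.range fun n : ℕ => g (t - 1 / ((n : ℝ) + 1))) z := by
  have : upperBounds (g '' Set.Iio t) =
      upperBounds (Set.range fun n : ℕ => g (t - 1 / ((n : ℝ) + 1))) := by
    ext w
    constructor
    · rintro h _ ⟨n, rfl⟩
      exact h ⟨_, sub_lt_self t (Nat.one_div_pos_of_nat), rfl⟩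
    · rintro h _ ⟨s, hs, rfl⟩
      obtain ⟨n, hn⟩ := exists_nat_one_div_lt (sub_pos.2 (Set.mem_Iio.1 hs))
      exact (hg s _ (by linarith) (sub_lt_self t (Nat.one_div_pos_of_nat))).trans (h ⟨n, rfl⟩)
  unfold IsLUB
  rw [this]

theorem monotone_sub_one_div (t : ℝ) : Monotone fun n : ℕ => t - 1 / ((n : ℝ) + 1) :=
  fun _ _ h => sub_le_sub_left (Nat.one_div_le_one_div h) t

variable {M : Type u} [PosOrdMonoid M] [QSemigroup M]

/-! ### Calculus of paths and suprema of increasing sequences of paths -/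

namespace TauPath

/-- The extension of a path to all reals that is constant on the positive reals. -/
def ev (f : TauPath M) (t : ℝ) : M := f.toFun ⟨min t 0, Set.mem_Iic.2 (min_le_right t 0)⟩

theorem toFun_eq_ev (f : TauPath M) (t : Set.Iic (0 : ℝ)) : f.toFun t = f.ev t :=
  congrArg f.toFun (Subtype.ext (min_eq_left t.2).symm)

theorem endpoint_eq_ev (f : TauPath M) : f.endpoint = f.ev 0 := f.toFun_eq_ev _

theorem ev_mono (f : TauPath M) : Monotone f.ev := fun _ _ h =>
  f.mono (Subtype.mk_le_mk.2 (min_le_min_right 0 h))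

theorem ev_prec (f : TauPath M) {s t : ℝ} (h : s < t) (ht : t ≤ 0) :
    QSemigroup.prec (f.ev s) (f.ev t) := by
  refine f.prec _ _ (Subtype.mk_lt_mk.2 ?_)
  rwa [min_eq_left (h.le.trans ht), min_eq_left ht]

theorem ev_isLUB (f : TauPath M) {t : ℝ} (ht : t ≤ 0) : IsLUB (f.ev '' Set.Iio t) (f.ev t) := by
  have h := f.sup ⟨t, ht⟩
  rw [toFun_eq_ev] at h
  convert h using 1
  ext y
  constructor
  · rintro ⟨s, hs, rfl⟩
    exact ⟨⟨s, (le_of_lt hs).trans ht⟩, hs, f.toFun_eq_ev _⟩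
  · rintro ⟨s, hs, rfl⟩
    exact ⟨s, hs, (f.toFun_eq_ev _).symm⟩

theorem ev_isLUB_seq (f : TauPath M) {t : ℝ} (ht : t ≤ 0) :
    IsLUB (Set.range fun n : ℕ => f.ev (t - 1 / ((n : ℝ) + 1))) (f.ev t) :=
  (isLUB_image_Iio_iff (fun _ _ h _ => f.ev_mono h) _).1 (f.ev_isLUB ht)

theorem add_ev (f g : TauPath M) (t : ℝ) : (f.add g).ev t = f.ev t + g.ev t := rfl

/-- The auxiliary relation may be weakened to `≤`, because `f` itself supplies a `≺` between the
times `t` and `t / 2`. -/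
theorem below_iff {f g : TauPath M} :
    f.Below g ↔ ∀ t : ℝ, t < 0 → ∃ t' : ℝ, t' < 0 ∧ f.ev t ≤ g.ev t' := by
  constructor
  · intro h t ht
    obtain ⟨t', ht', hp⟩ := h ⟨t, ht.le⟩ ht
    rw [toFun_eq_ev, toFun_eq_ev] at hp
    exact ⟨t', ht', QSemigroup.le_of_prec _ _ hp⟩
  · rintro h ⟨t, ht0⟩ (ht : t < 0)
    obtain ⟨t', ht', hp⟩ := h (t / 2) (by linarith)
    refine ⟨⟨t', ht'.le⟩, ht', ?_⟩
    rw [toFun_eq_ev, toFun_eq_ev]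
    exact QSemigroup.prec_mono _ _ _ _ le_rfl (f.ev_prec (show t < t / 2 by linarith) (by linarith))
      hp

/-- Left regularization of a `prec`-increasing family. -/
theorem exists_of_chain (g : ℝ → M) (hg : ∀ s t, s < t → t < 0 → QSemigroup.prec (g s) (g t)) :
    ∃ f : TauPath M, ∀ t ≤ 0, IsLUB (g '' Set.Iio t) (f.ev t) := by
  have hm : ∀ s s' : ℝ, s ≤ s' → s' < 0 → g s ≤ g s' := by
    intro s s' h hs'
    rcases h.eq_or_lt with rfl | h
    · exact le_rfl
    · exact QSemigroup.le_of_prec _ _ (hg _ _ h hs')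
  have hex : ∀ t : Set.Iic (0 : ℝ), ∃ z, IsLUB (g '' Set.Iio t.1) z := by
    rintro ⟨t, ht : t ≤ 0⟩
    have hm' : ∀ n : ℕ, t - 1 / ((n : ℝ) + 1) < 0 := fun n =>
      (sub_lt_self t Nat.one_div_pos_of_nat).trans_le ht
    obtain ⟨z, hz⟩ := QSemigroup.o1 (fun n : ℕ => g (t - 1 / ((n : ℝ) + 1)))
      fun a b h => hm _ _ (monotone_sub_one_div t h) (hm' b)
    exact ⟨z, (isLUB_image_Iio_iff (fun s s' h h' => hm s s' h (h'.trans_le ht)) z).2 hz⟩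
  choose F hF using hex
  have hmono : Monotone F := fun s t h => (hF s).2 fun y hy => by
    obtain ⟨r, hr, rfl⟩ := hy
    exact (hF t).1 ⟨r, Set.mem_Iio.2 (lt_of_lt_of_le (Set.mem_Iio.1 hr) h), rfl⟩
  refine ⟨⟨F, hmono, ?_, ?_⟩, ?_⟩
  · refine fun t => ⟨?_, fun w hw => (hF t).2 ?_⟩
    · rintro _ ⟨s, hs, rfl⟩
      exact hmono (le_of_lt hs)
    · rintro _ ⟨r, hr, rfl⟩
      obtain ⟨s, hs, hst⟩ := exists_between (show r < t.1 from hr)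
      exact ((hF ⟨s, hst.le.trans t.2⟩).1 ⟨r, hs, rfl⟩).trans
        (hw ⟨⟨s, hst.le.trans t.2⟩, hst, rfl⟩)
  · rintro ⟨s, hs0⟩ ⟨t, ht0 : t ≤ 0⟩ (hst : s < t)
    obtain ⟨r, hsr, hrt⟩ := exists_between hst
    -- Two intermediate times are used: `F s ≤ g r ≺ g r' ≤ F t`.
    obtain ⟨r', hr, hrt'⟩ := exists_between hrt
    refine QSemigroup.prec_mono _ _ _ _ ?_ (hg r r' hr (hrt'.trans_le ht0))
      ((hF ⟨t, ht0⟩).1 ⟨r', hrt', rfl⟩)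
    refine (hF ⟨s, hs0⟩).2 ?_
    rintro _ ⟨q, hq, rfl⟩
    exact hm q r ((le_of_lt hq).trans hsr.le) (hrt.trans_le ht0)
  · intro t ht
    have := hF ⟨min t 0, Set.mem_Iic.2 (min_le_right t 0)⟩
    rwa [show ((⟨min t 0, Set.mem_Iic.2 (min_le_right t 0)⟩ : Set.Iic (0 : ℝ)) : ℝ) = t from
      min_eq_left ht] at this

/-- The path that is obtained by translation. -/
def shift (f : TauPath M) (r : ℝ) (hr : r ≤ 0) : TauPath M where
  toFun t := f.ev (t + r)
  mono _ _ h := f.ev_mono (add_le_add_left (show (_ : ℝ) ≤ _ from h) r)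
  sup t := by
    convert f.ev_isLUB (add_nonpos t.2 hr) using 1
    ext y
    constructor
    · rintro ⟨s, hs, rfl⟩
      exact ⟨s + r, add_lt_add_left (show (s : ℝ) < t from hs) r, rfl⟩
    · rintro ⟨s, hs : s < t + r, rfl⟩
      have ht : (t : ℝ) ≤ 0 := t.2
      refine ⟨⟨s - r, show s - r ≤ 0 by linarith⟩, show s - r < t by linarith, ?_⟩
      simp
  prec _ t h := f.ev_prec (add_lt_add_left (show (_ : ℝ) < _ from h) r) (add_nonpos t.2 hr)

theorem shift_ev (f : TauPath M) {r : ℝ} (hr : r ≤ 0) {t : ℝ} (ht : t ≤ 0) :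
    (f.shift r hr).ev t = f.ev (t + r) := by
  change f.ev (min t 0 + r) = _
  rw [min_eq_left ht]

/-- The filter form lets finitely many such conditions be met at one common time. -/
theorem Below.eventually {f g : TauPath M} (h : f.Below g) {t : ℝ} (ht : t < 0) :
    ∀ᶠ c in nhdsWithin (0 : ℝ) (Set.Iio 0), QSemigroup.prec (f.ev t) (g.ev c) := by
  obtain ⟨t', ht', hp⟩ := h ⟨t, ht.le⟩ ht
  rw [toFun_eq_ev, toFun_eq_ev] at hp
  filter_upwards [Ioo_mem_nhdsLT (show (t' : ℝ) < 0 from ht')] with c hc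
  exact QSemigroup.prec_mono _ _ _ _ le_rfl hp (g.ev_mono hc.1.le)

/-- An increasing sequence of paths has a supremum that is attained levelwise. -/
theorem exists_sup (f : ℕ → TauPath M) (hf : ∀ m n, m ≤ n → (f m).Below (f n)) :
    ∃ g : TauPath M, (∀ n, (f n).Below g) ∧
      ∀ t < 0, ∃ n, ∃ t' < 0, g.ev t ≤ (f n).ev t' := by
  -- The first condition links consecutive paths of the diagonal by `≺`. The second makes the
  -- diagonal dominate all earlier paths, at times that tend to `0`.
  have step : ∀ (n : ℕ) (a : ℝ), ∃ c : ℝ, c < 0 ∧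
      (a < 0 → QSemigroup.prec ((f n).ev a) ((f (n + 1)).ev c)) ∧
      ∀ k ≤ n, (f k).ev (-(1 / ((n : ℝ) + 1))) ≤ (f (n + 1)).ev c := by
    intro n a
    have h1 : ∀ᶠ c in nhdsWithin (0 : ℝ) (Set.Iio 0),
        (a < 0 → QSemigroup.prec ((f n).ev a) ((f (n + 1)).ev c)) := by
      by_cases ha : a < 0
      · filter_upwards [(hf n (n + 1) n.le_succ).eventually ha] with c hc _ using hc
      · exact Filter.Eventually.of_forall fun c h => absurd h ha
    have h2 : ∀ᶠ c in nhdsWithin (0 : ℝ) (Set.Iio 0),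
        ∀ k ∈ Set.Iic n, (f k).ev (-(1 / ((n : ℝ) + 1))) ≤ (f (n + 1)).ev c := by
      refine (Filter.eventually_all_finite (Set.finite_Iic n)).2 fun k hk => ?_
      filter_upwards [(hf k (n + 1) (le_trans hk n.le_succ)).eventually
        (neg_lt_zero.2 (Nat.one_div_pos_of_nat (n := n)))] with c hc
      exact QSemigroup.le_of_prec _ _ hc
    obtain ⟨c, hc0, hc1, hc2⟩ := (eventually_mem_nhdsWithin.and (h1.and h2)).exists
    exact ⟨c, hc0, hc1, hc2⟩
  choose φ hφ0 hφ1 hφ2 using step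
  let c : ℕ → ℝ := fun n => Nat.rec (-1) (fun n c => φ n (c / 2)) n
  have hc0 : ∀ n, c n < 0 := by
    rintro (_ | n)
    · exact neg_one_lt_zero
    · exact hφ0 _ _
  have hc1 : ∀ n, QSemigroup.prec ((f n).ev (c n / 2)) ((f (n + 1)).ev (c (n + 1))) := fun n =>
    hφ1 n (c n / 2) (by linarith [hc0 n])
  have hc2 : ∀ n, ∀ k ≤ n, (f k).ev (-(1 / ((n : ℝ) + 1))) ≤ (f (n + 1)).ev (c (n + 1)) := fun n =>
    hφ2 n (c n / 2)
  have hcm : Monotone fun n => (f n).ev (c n) := monotone_nat_of_le_succ fun n =>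
    ((f n).ev_mono (by linarith [hc0 n])).trans (QSemigroup.le_of_prec _ _ (hc1 n))
  -- On `[n, n + 1)` this runs along `f n` from time `c n` towards `c n / 2`; the jump to `f (n +
  -- 1)` at time `c (n + 1)` is a `≺` by `hc1`.
  let h : ℝ → M := fun u => (f ⌊u⌋₊).ev (c ⌊u⌋₊ * (1 - (u - ⌊u⌋₊) / 2))
  have hlow : ∀ u, 0 < u → (f ⌊u⌋₊).ev (c ⌊u⌋₊) ≤ h u := by
    intro u hu
    refine (f _).ev_mono ?_
    have := Nat.floor_le hu.le
    nlinarith [hc0 ⌊u⌋₊]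
  have hup : ∀ u, 0 < u → h u ≤ (f ⌊u⌋₊).ev (c ⌊u⌋₊ / 2) := by
    intro u hu
    refine (f _).ev_mono ?_
    have := Nat.lt_floor_add_one u
    nlinarith [hc0 ⌊u⌋₊]
  have hprec : ∀ u v, 0 < u → u < v → QSemigroup.prec (h u) (h v) := by
    intro u v hu huv
    rcases (Nat.floor_le_floor huv.le).eq_or_lt with he | hlt
    · change QSemigroup.prec ((f ⌊u⌋₊).ev _) ((f ⌊v⌋₊).ev _)
      rw [← he]
      refine (f _).ev_prec ?_ ?_
      · nlinarith [hc0 ⌊u⌋₊]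
      · have := Nat.lt_floor_add_one v
        rw [← he] at this
        nlinarith [hc0 ⌊u⌋₊]
    · refine QSemigroup.prec_mono _ _ _ _ (hup u hu) (hc1 _) ?_
      exact (hcm hlt).trans (hlow v (hu.trans huv))
  obtain ⟨g, hg⟩ := exists_of_chain (fun t => h (-t⁻¹)) fun s t hst ht =>
    hprec _ _ (neg_pos.2 (inv_lt_zero.2 (hst.trans ht))) (neg_inv_lt_neg_inv hst ht)
  refine ⟨g, fun k => below_iff.2 fun t ht => ?_, fun t ht => ?_⟩
  · obtain ⟨n, hn⟩ := exists_nat_one_div_lt (neg_pos.2 ht)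
    have hN : (0 : ℝ) < ((max n k + 1 : ℕ) : ℝ) := by positivity
    -- At time `-N⁻¹` the diagonal is at the integer `N = max n k + 1`, where `hc2` applies. Halving
    -- the time is needed because `g` takes suprema over strictly earlier times.
    refine ⟨-((max n k + 1 : ℕ) : ℝ)⁻¹ / 2, by have := inv_pos.2 hN; linarith, ?_⟩
    have hle : -((max n k + 1 : ℕ) : ℝ)⁻¹ / 2 ≤ 0 := by have := inv_pos.2 hN; linarith
    refine le_trans ?_ ((hg _ hle).1 ⟨-((max n k + 1 : ℕ) : ℝ)⁻¹, ?_, rfl⟩)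
    · refine le_trans ?_ (hlow _ ?_)
      · simp only [inv_neg, inv_inv, neg_neg, Nat.floor_natCast]
        refine le_trans ((f k).ev_mono ?_) (hc2 (max n k) k (le_max_right _ _))
        have : 1 / (((max n k : ℕ) : ℝ) + 1) ≤ 1 / ((n : ℝ) + 1) :=
          Nat.one_div_le_one_div (le_max_left n k)
        linarith
      · simp only [inv_neg, inv_inv, neg_neg]
        exact hN
    · have := inv_pos.2 hN
      exact Set.mem_Iio.2 (by linarith)
  · have hu : 0 < -t⁻¹ := neg_pos.2 (inv_lt_zero.2 ht)
    refine ⟨⌊-t⁻¹⌋₊, c ⌊-t⁻¹⌋₊ / 2, by linarith [hc0 ⌊-t⁻¹⌋₊], le_trans ?_ (hup _ hu)⟩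
    refine (hg t ht.le).2 ?_
    rintro _ ⟨s, hs : s < t, rfl⟩
    exact QSemigroup.le_of_prec _ _ (hprec _ _ (neg_pos.2 (inv_lt_zero.2 (hs.trans ht)))
      (neg_inv_lt_neg_inv hs ht))

end TauPath

/-! ### Suprema and way-below in the τ-construction -/

namespace Tau

theorem mk_surjective (x : Tau M) : ∃ f, x = mk f := by
  obtain ⟨f, hf⟩ := Quotient.exists_rep x
  exact ⟨f, hf.symm⟩

/-- An upper bound of the sequence dominates each member level by level, hence dominates every level
of `g`. -/
theorem isLUB_mk {f : ℕ → TauPath M} {g : TauPath M} (h₁ : ∀ n, (f n).Below g)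
    (h₂ : ∀ t < 0, ∃ n, ∃ t' < 0, g.ev t ≤ (f n).ev t') :
    IsLUB (Set.range fun n => mk (f n)) (mk g) := by
  constructor
  · rintro _ ⟨n, rfl⟩
    exact h₁ n
  · intro w hw
    obtain ⟨k, rfl⟩ := mk_surjective w
    refine TauPath.below_iff.2 fun t ht => ?_
    obtain ⟨n, t', ht', hle⟩ := h₂ t ht
    obtain ⟨t'', ht'', hle'⟩ := TauPath.below_iff.1 (mk_le_mk.1 (hw ⟨n, rfl⟩)) t' ht'
    exact ⟨t'', ht'', hle.trans hle'⟩

/-- Suprema in `τ(M)` are attained levelwise. -/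
theorem exists_le_of_isLUB {f : ℕ → TauPath M} (hf : Monotone fun n => mk (f n)) {g : TauPath M}
    (hg : IsLUB (Set.range fun n => mk (f n)) (mk g)) {t : ℝ} (ht : t < 0) :
    ∃ n, ∃ t' < 0, g.ev t ≤ (f n).ev t' := by
  obtain ⟨k, hk₁, hk₂⟩ := TauPath.exists_sup f fun m n h => mk_le_mk.1 (hf h)
  have h := hg.unique (isLUB_mk hk₁ hk₂)
  obtain ⟨t', ht', hle⟩ := TauPath.below_iff.1 (mk_le_mk.1 h.le) t ht
  obtain ⟨n, t'', ht'', hle'⟩ := hk₂ t' ht'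
  exact ⟨n, t'', ht'', hle.trans hle'⟩

theorem exists_seq_mk (s : ℕ → Tau M) : ∃ f : ℕ → TauPath M, s = fun n => mk (f n) := by
  choose f hf using fun n => mk_surjective (s n)
  exact ⟨f, funext hf⟩

/-- Once a supremum dominates `g`, a single member of the sequence reaches the level `g.ev r`, since
suprema are attained levelwise. That one level bounds all of `f`. -/
theorem mk_wayBelow_of_le {f g : TauPath M} {r : ℝ} (hr : r < 0) (h : ∀ t < 0, f.ev t ≤ g.ev r) :
    WayBelow (mk f) (mk g) := by
  intro s hs z hz hle
  obtain ⟨k, rfl⟩ := exists_seq_mk s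
  obtain ⟨w, rfl⟩ := mk_surjective z
  obtain ⟨t', ht', hgw⟩ := TauPath.below_iff.1 (mk_le_mk.1 hle) r hr
  obtain ⟨n, t'', ht'', hwk⟩ := exists_le_of_isLUB hs hz ht'
  exact ⟨n, TauPath.below_iff.2 fun t ht => ⟨t'', ht'', ((h t ht).trans hgw).trans hwk⟩⟩

theorem shift_wayBelow (f : TauPath M) {r r' : ℝ} (h : r < r') (hr' : r' ≤ 0) :
    WayBelow (mk (f.shift r (h.le.trans hr'))) (mk (f.shift r' hr')) := by
  refine mk_wayBelow_of_le (r := r - r') (by linarith) fun t ht => ?_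
  rw [TauPath.shift_ev _ _ ht.le, TauPath.shift_ev _ _ (by linarith)]
  exact f.ev_mono (by linarith)

theorem shift_wayBelow_self (f : TauPath M) {r : ℝ} (hr : r < 0) :
    WayBelow (mk (f.shift r hr.le)) (mk f) := by
  refine mk_wayBelow_of_le hr fun t ht => ?_
  rw [TauPath.shift_ev _ _ ht.le]
  exact f.ev_mono (by linarith)

theorem exists_shift_seq (f : TauPath M) : ∃ s : ℕ → Tau M, (∀ n, WayBelow (s n) (s (n + 1))) ∧
    IsLUB (Set.range s) (mk f) ∧ ∀ n, ∃ r, ∃ hr : r < 0, s n = mk (f.shift r hr.le) := by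
  have hneg : ∀ n : ℕ, -(1 / ((n : ℝ) + 1)) < 0 := fun n => neg_lt_zero.2 Nat.one_div_pos_of_nat
  refine ⟨fun n => mk (f.shift (-(1 / ((n : ℝ) + 1))) (hneg n).le), fun n => ?_, ?_,
    fun n => ⟨_, hneg n, rfl⟩⟩
  · exact shift_wayBelow f (neg_lt_neg (Nat.one_div_lt_one_div n.lt_succ_self)) _
  · refine isLUB_mk (fun n => mk_le_mk.1 (shift_wayBelow_self f (hneg n)).le) fun t ht => ?_
    obtain ⟨n, hn⟩ := exists_nat_one_div_lt (neg_pos.2 ht)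
    refine ⟨n, t + 1 / ((n : ℝ) + 1), by linarith, ?_⟩
    rw [TauPath.shift_ev _ _ (by linarith)]
    exact f.ev_mono (by linarith)

theorem exists_shift_of_wayBelow {x : Tau M} {f : TauPath M} (h : WayBelow x (mk f)) :
    ∃ r, ∃ hr : r < 0, x ≤ mk (f.shift r hr.le) := by
  obtain ⟨s, hs, hf, hr⟩ := exists_shift_seq f
  obtain ⟨k, hk⟩ := h s (monotone_of_wayBelow hs) _ hf le_rfl
  obtain ⟨r, hr, he⟩ := hr k
  exact ⟨r, hr, he ▸ hk⟩

theorem shift_mono (f : TauPath M) {r r' : ℝ} (h : r ≤ r') (hr : r ≤ 0) (hr' : r' ≤ 0) :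
    mk (f.shift r hr) ≤ mk (f.shift r' hr') := by
  refine mk_le_mk.2 (TauPath.below_iff.2 fun t ht => ⟨t, ht, ?_⟩)
  rw [TauPath.shift_ev _ _ ht.le, TauPath.shift_ev _ _ ht.le]
  exact f.ev_mono (by linarith)

/-- The τ-construction yields Cu-semigroups. -/
theorem isCuSemigroup (M : Type u) [PosOrdMonoid M] [QSemigroup M] : IsCuSemigroup (Tau M) where
  o1 s hs := by
    obtain ⟨f, rfl⟩ := exists_seq_mk s
    obtain ⟨k, hk₁, hk₂⟩ := TauPath.exists_sup f fun m n h => mk_le_mk.1 (hs h)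
    exact ⟨mk k, isLUB_mk hk₁ hk₂⟩
  o2 x := by
    obtain ⟨f, rfl⟩ := mk_surjective x
    obtain ⟨s, hs, hf, -⟩ := exists_shift_seq f
    exact ⟨s, hs, hf⟩
  o3 x' x y' y hx hy := by
    obtain ⟨f, rfl⟩ := mk_surjective x
    obtain ⟨g, rfl⟩ := mk_surjective y
    obtain ⟨r, hr, hxr⟩ := exists_shift_of_wayBelow hx
    obtain ⟨q, hq, hyq⟩ := exists_shift_of_wayBelow hy
    have hm : max r q < 0 := max_lt hr hq
    refine WayBelow.mono ?_ (shift_wayBelow_self (f.add g) hm) le_rfl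
    exact add_le_add (hxr.trans (shift_mono f (le_max_left r q) hr.le hm.le))
      (hyq.trans (shift_mono g (le_max_right r q) hq.le hm.le))
  o4 s t hs ht x y hx hy := by
    obtain ⟨f, rfl⟩ := exists_seq_mk s
    obtain ⟨g, rfl⟩ := exists_seq_mk t
    obtain ⟨h, rfl⟩ := mk_surjective x
    obtain ⟨k, rfl⟩ := mk_surjective y
    refine isLUB_mk (f := fun n => (f n).add (g n)) (g := h.add k)
      (fun n => mk_le_mk.1 (add_le_add (hx.1 ⟨n, rfl⟩) (hy.1 ⟨n, rfl⟩))) fun t ht0 => ?_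
    obtain ⟨m, a, ha, hma⟩ := exists_le_of_isLUB hs hx ht0
    obtain ⟨n, b, hb, hnb⟩ := exists_le_of_isLUB ht hy ht0
    obtain ⟨a', ha', hma'⟩ := TauPath.below_iff.1 (mk_le_mk.1 (hs (le_max_left m n))) a ha
    obtain ⟨b', hb', hnb'⟩ := TauPath.below_iff.1 (mk_le_mk.1 (ht (le_max_right m n))) b hb
    refine ⟨max m n, max a' b', max_lt ha' hb', ?_⟩
    rw [TauPath.add_ev, TauPath.add_ev]
    exact add_le_add ((hma.trans hma').trans (TauPath.ev_mono _ (le_max_left _ _)))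
      ((hnb.trans hnb').trans (TauPath.ev_mono _ (le_max_right _ _)))

theorem endpoint_preservesSeqSup : PreservesSeqSup (endpoint M) := by
  intro s hs z hz
  obtain ⟨f, rfl⟩ := exists_seq_mk s
  obtain ⟨g, rfl⟩ := mk_surjective z
  refine ⟨?_, fun w hw => ?_⟩
  · rintro _ ⟨n, rfl⟩
    exact (endpoint M).monotone' (hz.1 ⟨n, rfl⟩)
  · change g.endpoint ≤ w
    rw [TauPath.endpoint_eq_ev]
    refine (g.ev_isLUB le_rfl).2 ?_
    rintro _ ⟨t, ht, rfl⟩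
    obtain ⟨n, t', ht', hle⟩ := exists_le_of_isLUB hs hz ht
    refine (hle.trans ((f n).ev_mono ht'.le)).trans ?_
    rw [← TauPath.endpoint_eq_ev]
    exact hw ⟨n, rfl⟩

/-- An element way below the class of `f` lies under a translate of `f` by some `r < 0`, whose
endpoint `f.ev r` is `≺ f.ev 0`. -/
theorem endpoint_prec {x y : Tau M} (h : WayBelow x y) :
    QSemigroup.prec (endpoint M x) (endpoint M y) := by
  obtain ⟨f, rfl⟩ := mk_surjective y
  obtain ⟨r, hr, hle⟩ := exists_shift_of_wayBelow h
  refine QSemigroup.prec_mono _ _ _ _ (((endpoint M).monotone' hle).trans ?_) (f.ev_prec hr le_rfl)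
    f.endpoint_eq_ev.ge
  change f.ev (0 + r) ≤ _
  rw [zero_add]

end Tau

/-! ### Lifting morphisms to the τ-construction, and uniqueness of lifts -/

namespace Tau

variable {T M : Type u} [PosOrdMonoid T] [PosOrdMonoid M] [QSemigroup M]

/-- The path `f` describes `φ x` through elements way below `x`. -/
structure IsLift (φ : T →+o M) (x : T) (f : TauPath M) : Prop where
  le : ∀ t < 0, ∃ x', WayBelow x' x ∧ f.ev t ≤ φ x'
  ge : ∀ x', WayBelow x' x → ∃ t < 0, φ x' ≤ f.ev t

namespace IsLift

variable {φ : T →+o M} {x y : T} {f g : TauPath M}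

/-- For `x = y` this makes the class of a lift independent of the chosen path; additivity of the
lifted map then reduces to `IsLift.add`. -/
theorem below (hf : IsLift φ x f) (hg : IsLift φ y g) (h : x ≤ y) : f.Below g := by
  refine TauPath.below_iff.2 fun t ht => ?_
  obtain ⟨x', hx', hle⟩ := hf.le t ht
  obtain ⟨t', ht', hle'⟩ := hg.ge x' (hx'.mono le_rfl h)
  exact ⟨t', ht', hle.trans hle'⟩

theorem add (hT : IsCuSemigroup T) (hf : IsLift φ x f) (hg : IsLift φ y g) :
    IsLift φ (x + y) (f.add g) where
  le t ht := by
    obtain ⟨x', hx', hx⟩ := hf.le t ht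
    obtain ⟨y', hy', hy⟩ := hg.le t ht
    refine ⟨x' + y', hT.o3 _ _ _ _ hx' hy', ?_⟩
    rw [TauPath.add_ev, map_add]
    exact add_le_add hx hy
  ge z hz := by
    obtain ⟨x', y', hx', hy', hle⟩ := hT.exists_add hz
    obtain ⟨t, ht, hx⟩ := hf.ge x' hx'
    obtain ⟨s, hs, hy⟩ := hg.ge y' hy'
    refine ⟨max t s, max_lt ht hs, (φ.monotone' hle).trans ?_⟩
    change φ (x' + y') ≤ _
    rw [TauPath.add_ev, map_add]
    exact add_le_add (hx.trans (f.ev_mono (le_max_left _ _)))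
      (hy.trans (g.ev_mono (le_max_right _ _)))

theorem zero : IsLift φ (0 : T) TauPath.zero where
  le _ _ := ⟨0, zero_wayBelow 0, PosOrdMonoid.zero_le_all _⟩
  ge x' hx' := by
    refine ⟨-1, neg_one_lt_zero, (φ.monotone' hx'.le).trans ?_⟩
    exact (map_zero φ).le

theorem ev_le (hf : IsLift φ x f) {t : ℝ} (ht : t < 0) : f.ev t ≤ φ x := by
  obtain ⟨x', hx', hle⟩ := hf.le t ht
  exact hle.trans (φ.monotone' hx'.le)

theorem endpoint_eq (hT : IsCuSemigroup T) (hφ : PreservesSeqSup φ) (hf : IsLift φ x f) :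
    f.endpoint = φ x := by
  rw [f.endpoint_eq_ev]
  refine le_antisymm ((f.ev_isLUB le_rfl).2 ?_) ?_
  · rintro _ ⟨t, ht, rfl⟩
    exact hf.ev_le ht
  · obtain ⟨s, hs, hsx, hx⟩ := hT.exists_approx x
    refine (hφ s hs x hx).2 ?_
    rintro _ ⟨n, rfl⟩
    obtain ⟨t, ht, hle⟩ := hf.ge _ (hsx n)
    exact hle.trans (f.ev_mono ht.le)

theorem exists_lift (hT : IsCuSemigroup T) (φ : T →+o M)
    (hφ : ∀ x y, WayBelow x y → QSemigroup.prec (φ x) (φ y)) (x : T) : ∃ f, IsLift φ x f := by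
  obtain ⟨g, hg, hx⟩ := hT.exists_chain x
  obtain ⟨f, hf⟩ := TauPath.exists_of_chain (fun t => φ (g t))
    fun s t hst ht => hφ _ _ (hg s t hst ht)
  refine ⟨f, fun t ht => ⟨g t, ?_, ?_⟩, fun x' hx' => ?_⟩
  · exact (hg t (t / 2) (by linarith) (by linarith)).mono le_rfl
      (hx.1 ⟨t / 2, Set.mem_Iio.2 (by linarith), rfl⟩)
  · refine (hf t ht.le).2 ?_
    rintro _ ⟨s, hs, rfl⟩
    exact φ.monotone' (hg s t hs ht).le
  · have hm : ∀ s s' : ℝ, s ≤ s' → s' < 0 → g s ≤ g s' := by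
      intro s s' h hs'
      rcases h.eq_or_lt with rfl | h
      · exact le_rfl
      · exact (hg _ _ h hs').le
    have hneg : ∀ n : ℕ, 0 - 1 / ((n : ℝ) + 1) < 0 := fun n => sub_lt_self 0 Nat.one_div_pos_of_nat
    obtain ⟨k, hk⟩ := hx' _ (fun a b h => hm _ _ (monotone_sub_one_div 0 h) (hneg b)) x
      ((isLUB_image_Iio_iff hm x).1 hx) le_rfl
    have := hneg k
    refine ⟨(0 - 1 / ((k : ℝ) + 1)) / 2, by linarith, (φ.monotone' hk).trans ?_⟩
    exact (hf _ (by linarith)).1 ⟨_, Set.mem_Iio.2 (by linarith), rfl⟩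

end IsLift

/-- Morphisms into a Q-semigroup lift to the τ-construction. -/
theorem exists_lift (hT : IsCuSemigroup T) (φ : T →+o M) (hsup : PreservesSeqSup φ)
    (hφ : ∀ x y, WayBelow x y → QSemigroup.prec (φ x) (φ y)) :
    ∃ α : T →+o Tau M, IsCuMorphism α ∧ ∀ x, endpoint M (α x) = φ x := by
  choose f hf using IsLift.exists_lift hT φ hφ
  have hle : ∀ x y, x ≤ y → mk (f x) ≤ mk (f y) := fun x y h => mk_le_mk.2 ((hf x).below (hf y) h)
  have heq : ∀ x g, IsLift φ x g → mk (f x) = mk g := fun x g hg =>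
    le_antisymm (mk_le_mk.2 ((hf x).below hg le_rfl)) (mk_le_mk.2 (hg.below (hf x) le_rfl))
  refine ⟨⟨⟨⟨fun x => mk (f x), heq 0 _ .zero⟩, fun x y =>
    heq _ _ ((hf x).add hT (hf y))⟩, hle⟩, ⟨?_, ?_⟩, fun x => (hf x).endpoint_eq hT hsup⟩
  · intro x y hxy
    -- Some value `(f y).ev r` with `r < 0` dominates `φ z`, hence all of the path `f x` before time
    -- `0`.
    obtain ⟨z, hxz, hzy⟩ := hT.exists_between hxy
    obtain ⟨r, hr, hle⟩ := (hf y).ge z hzy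
    exact mk_wayBelow_of_le hr fun t ht =>
      (((hf x).ev_le ht).trans (φ.monotone' hxz.le)).trans hle
  · intro s hs z hz
    refine isLUB_mk (f := fun n => f (s n)) (fun n => mk_le_mk.1 (hle _ _ (hz.1 ⟨n, rfl⟩)))
      fun t ht => ?_
    obtain ⟨z', hz', hle⟩ := (hf z).le t ht
    obtain ⟨z'', h1, h2⟩ := hT.exists_between hz'
    obtain ⟨n, hn⟩ := h2 s hs z hz le_rfl
    obtain ⟨t', ht', hle'⟩ := (hf (s n)).ge z' (h1.mono le_rfl hn)
    exact ⟨n, t', ht', hle.trans hle'⟩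

/-- For `x'` way below `x`, the element `β x'` lies under a proper translate of a path `g` for `β
x`. So the endpoint shared by `α x'` and `β x'` is at most `g.ev r` with `r < 0`, and this alone
forces `α x' ≤ β x`. -/
theorem le_of_endpoint_eq (hT : IsCuSemigroup T) {α β : T →+o Tau M} (hα : IsCuMorphism α)
    (hβ : IsCuMorphism β) (h : ∀ x, endpoint M (α x) = endpoint M (β x)) (x : T) : α x ≤ β x := by
  obtain ⟨s, hs, hsx, hx⟩ := hT.exists_approx x
  refine (hα.map_sup s hs x hx).2 ?_
  rintro _ ⟨n, rfl⟩
  obtain ⟨g, hg⟩ := mk_surjective (β x)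
  obtain ⟨f, hf⟩ := mk_surjective (α (s n))
  have hb := hβ.map_wayBelow _ _ (hsx n)
  rw [hg] at hb
  obtain ⟨r, hr, hle⟩ := exists_shift_of_wayBelow hb
  have he : f.ev 0 ≤ g.ev r := by
    have h1 := (endpoint M).monotone' hle
    have h2 : endpoint M (α (s n)) ≤ (g.shift r hr.le).endpoint := (h (s n)).trans_le h1
    rw [hf] at h2
    change f.endpoint ≤ _ at h2
    rwa [TauPath.endpoint_eq_ev, TauPath.endpoint_eq_ev, TauPath.shift_ev _ _ le_rfl, zero_add] at h2
  change α (s n) ≤ β x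
  rw [hf, hg]
  exact mk_le_mk.2 (TauPath.below_iff.2 fun t ht => ⟨r, hr, (f.ev_mono ht.le).trans he⟩)

/-- Cu-morphisms into the τ-construction are determined by their endpoints. -/
theorem hom_ext (hT : IsCuSemigroup T) {α β : T →+o Tau M} (hα : IsCuMorphism α)
    (hβ : IsCuMorphism β) (h : ∀ x, endpoint M (α x) = endpoint M (β x)) : α = β :=
  OrderAddMonoidHom.ext fun x => le_antisymm (le_of_endpoint_eq hT hα hβ h x)
    (le_of_endpoint_eq hT hβ hα (fun x => (h x).symm) x)

end Tau

/-! ### Limits of Cu-semigroups -/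

section Limit

variable {J : Type u} [SmallCategory J]

theorem isCuMorphism_tauProj (F : J ⥤ CuCat.{u}) (j : J) : IsCuMorphism (tauProj F j) where
  map_wayBelow _ _ h := Tau.endpoint_prec h j
  map_sup s hs z hz := PomLimit.isLUB_apply F (fun n => Tau.endpoint (PomLimit F) (s n))
    (fun _ _ h => (Tau.endpoint (PomLimit F)).monotone' (hs h)) _
    (Tau.endpoint_preservesSeqSup s hs z hz) j

/-- The compatible families that are induced by a cone. -/
def coneToPomLimit (F : J ⥤ CuCat.{u}) (c : Cone F) : c.pt.carrier →+o PomLimit F where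
  toFun x := ⟨fun j => CuCat.Hom.hom (c.π.app j) x, fun _ j f =>
    congrArg (fun g : c.pt ⟶ F.obj j => CuCat.Hom.hom g x) (c.w f)⟩
  map_zero' := Subtype.ext (funext fun j => map_zero (CuCat.Hom.hom (c.π.app j)))
  map_add' x y := Subtype.ext (funext fun j => map_add (CuCat.Hom.hom (c.π.app j)) x y)
  monotone' _ _ h j := (CuCat.Hom.hom (c.π.app j)).monotone' h

theorem exists_tauLift (F : J ⥤ CuCat.{u}) (c : Cone F) :
    ∃ α : c.pt.carrier →+o Tau (PomLimit F), IsCuMorphism α ∧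
      ∀ x, Tau.endpoint (PomLimit F) (α x) = coneToPomLimit F c x :=
  Tau.exists_lift c.pt.isCu (coneToPomLimit F c)
    (fun s hs z hz => PomLimit.isLUB_of_forall F _ _ fun j => (c.π.app j).isCu.map_sup s hs z hz)
    fun x y h j => (c.π.app j).isCu.map_wayBelow x y h

theorem tauLift_unique {T : Type u} [PosOrdMonoid T] (hT : IsCuSemigroup T) (F : J ⥤ CuCat.{u})
    {α β : T →+o Tau (PomLimit F)} (hα : IsCuMorphism α) (hβ : IsCuMorphism β)
    (h : ∀ j x, tauProj F j (α x) = tauProj F j (β x)) : α = β :=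
  Tau.hom_ext hT hα hβ fun x => Subtype.ext (funext fun j => h j x)

/-- The τ-construction yields limits of Cu-semigroups. -/
noncomputable def tauConeIsLimit (F : J ⥤ CuCat.{u}) (hCu : IsCuSemigroup (Tau (PomLimit F)))
    (hψ : ∀ j, IsCuMorphism (tauProj F j)) : IsLimit (tauCone F hCu hψ) where
  lift c := ⟨(exists_tauLift F c).choose, (exists_tauLift F c).choose_spec.1⟩
  fac c j := CuCat.Hom.ext (OrderAddMonoidHom.ext fun x =>
    congrArg (fun s : PomLimit F => s.1 j) ((exists_tauLift F c).choose_spec.2 x))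
  uniq c m hm := CuCat.Hom.ext (tauLift_unique c.pt.isCu F m.isCu
    (exists_tauLift F c).choose_spec.1 fun j x => by
      refine Eq.trans ?_
        (congrArg (fun s : PomLimit F => s.1 j) ((exists_tauLift F c).choose_spec.2 x)).symm
      exact congrArg (fun f : c.pt ⟶ F.obj j => CuCat.Hom.hom f x) (hm j))

instance : HasLimits CuCat.{u} where
  has_limits_of_shape _ _ :=
    { has_limit := fun F => ⟨⟨_, tauConeIsLimit F (Tau.isCuSemigroup _) (isCuMorphism_tauProj F)⟩⟩ }

/-! ### Limits of scaled Cu-semigroups -/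

theorem isCuIdeal_limitIdeal (F : J ⥤ CuSc.{u}) : IsCuIdeal (limitIdeal F) :=
  isCuIdeal_idealGen _

theorem isCuSemigroup_limitIdeal (F : J ⥤ CuSc.{u}) : IsCuSemigroup (limitIdeal F) :=
  ((isCuIdeal_limitIdeal F).embedding (Tau.isCuSemigroup _)).1

theorem isCuMorphism_limitIdeal_incl (F : J ⥤ CuSc.{u}) :
    IsCuMorphism (submonoidIncl (limitIdeal F)) :=
  ((isCuIdeal_limitIdeal F).embedding (Tau.isCuSemigroup _)).2.1

theorem isCuMorphism_limitProj (F : J ⥤ CuSc.{u}) (j : J) : IsCuMorphism (limitProj F j) :=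
  (isCuMorphism_tauProj (F ⋙ forgetScale) j).comp (isCuMorphism_limitIdeal_incl F)

theorem limitScaleZero_lower (F : J ⥤ CuSc.{u}) : IsLowerSet (limitScaleZero F) :=
  fun _ _ h hx j => (F.obj j).isScale.lower (h j) (hx j)

/-- One good representative suffices for all: equivalent paths dominate each other at negative
times, and `limitScaleZero` is downward hereditary. -/
theorem mk_mem_tauScale (F : J ⥤ CuSc.{u}) {f : TauPath (PomLimit (F ⋙ forgetScale))} :
    Tau.mk f ∈ tauScale F ↔ ∀ t < 0, f.ev t ∈ limitScaleZero F := by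
  constructor
  · rintro ⟨g, hfg, hg⟩ t ht
    obtain ⟨t', ht', hle⟩ := TauPath.below_iff.1 (Tau.mk_le_mk.1 hfg.le) t ht
    refine limitScaleZero_lower F hle ?_
    have := hg ⟨t', ht'.le⟩ ht'
    rwa [TauPath.toFun_eq_ev] at this
  · intro h
    refine ⟨f, rfl, fun t ht => ?_⟩
    rw [TauPath.toFun_eq_ev]
    exact h t ht

theorem tauScale_lower (F : J ⥤ CuSc.{u}) : IsLowerSet (tauScale F) := by
  intro x y hyx hx
  obtain ⟨f, rfl⟩ := Tau.mk_surjective x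
  obtain ⟨g, rfl⟩ := Tau.mk_surjective y
  rw [mk_mem_tauScale] at hx ⊢
  intro t ht
  obtain ⟨t', ht', hle⟩ := TauPath.below_iff.1 (Tau.mk_le_mk.1 hyx) t ht
  exact limitScaleZero_lower F hle (hx t' ht')

theorem tauScale_seqSupClosed (F : J ⥤ CuSc.{u}) : SeqSupClosed (tauScale F) := by
  intro s hs hmem z hz
  obtain ⟨f, rfl⟩ := Tau.exists_seq_mk s
  obtain ⟨g, rfl⟩ := Tau.mk_surjective z
  rw [mk_mem_tauScale]
  intro t ht
  obtain ⟨n, t', ht', hle⟩ := Tau.exists_le_of_isLUB hs hz ht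
  exact limitScaleZero_lower F hle ((mk_mem_tauScale F).1 (hmem n) t' ht')

theorem isScale_limitScale (F : J ⥤ CuSc.{u}) : IsScale (limitScale F) where
  lower _ _ h hx := tauScale_lower F h hx
  supClosed s hs hmem z hz := tauScale_seqSupClosed F (fun n => (s n).1) hs hmem _
    ((isCuMorphism_limitIdeal_incl F).map_sup s hs z hz)
  generates := by
    rw [idealGen, sInf_eq_top]
    rintro I ⟨hI, hsub⟩
    -- An ideal of an ideal is an ideal of the ambient semigroup, so minimality of `limitIdeal F`
    -- can be used there.
    have hmap : IsCuIdeal (I.map (limitIdeal F).subtype) := by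
      constructor
      · rintro _ y hy ⟨x, hx, rfl⟩
        exact ⟨⟨y, (isCuIdeal_limitIdeal F).1 hy x.2⟩, hI.1 hy hx, rfl⟩
      · intro s hs hmem z hz
        choose r hr hrs using hmem
        obtain rfl : (fun n => (r n : Tau (PomLimit (F ⋙ forgetScale)))) = s := funext hrs
        refine ⟨⟨z, (isCuIdeal_limitIdeal F).2 _ hs (fun n => (r n).2) z hz⟩,
          hI.2 r hs hr _ ⟨?_, fun w hw => hz.2 ?_⟩, rfl⟩
        · rintro _ ⟨n, rfl⟩
          exact hz.1 ⟨n, rfl⟩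
        · rintro _ ⟨n, rfl⟩
          exact hw ⟨n, rfl⟩
    have hle : limitIdeal F ≤ I.map (limitIdeal F).subtype := idealGen_le hmap fun x hx =>
      ⟨⟨x, subset_idealGen _ hx⟩, hsub hx, rfl⟩
    refine eq_top_iff.2 fun x _ => ?_
    obtain ⟨y, hy, hyx⟩ := hle x.2
    rwa [← Subtype.ext (a1 := y) (a2 := x) hyx]

theorem limitProj_mem_scale (F : J ⥤ CuSc.{u}) (j : J) (x : limitIdeal F) (hx : x ∈ limitScale F) :
    limitProj F j x ∈ (F.obj j).scale := by
  obtain ⟨x, hxI⟩ := x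
  obtain ⟨f, rfl⟩ := Tau.mk_surjective x
  change (f.endpoint).1 j ∈ _
  rw [f.endpoint_eq_ev]
  have hm : Monotone fun n : ℕ => f.ev (0 - 1 / ((n : ℝ) + 1)) :=
    fun _ _ h => f.ev_mono (monotone_sub_one_div 0 h)
  refine (F.obj j).isScale.supClosed (fun n => (f.ev (0 - 1 / ((n : ℝ) + 1))).1 j)
    (fun _ _ h => hm h j) (fun n => ?_) _ (PomLimit.isLUB_apply _ _ hm _ (f.ev_isLUB_seq le_rfl) j)
  exact (mk_mem_tauScale F).1 hx _ (sub_lt_self 0 Nat.one_div_pos_of_nat) j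

theorem exists_limitLift (F : J ⥤ CuSc.{u}) (c : Cone F) :
    ∃ α : c.pt.toCu.carrier →+o limitIdeal F, IsCuMorphism α ∧
      (∀ x ∈ c.pt.scale, α x ∈ limitScale F) ∧
      ∀ j x, limitProj F j (α x) = CuCat.Hom.hom (CuSc.Hom.toCu (c.π.app j)) x := by
  obtain ⟨α, hα, he⟩ := exists_tauLift (F ⋙ forgetScale) (forgetScale.mapCone c)
  have hsc : ∀ x ∈ c.pt.scale, α x ∈ tauScale F := by
    intro x hx
    obtain ⟨f, hf⟩ := Tau.mk_surjective (α x)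
    have h := he x
    rw [hf] at h ⊢
    change f.endpoint = _ at h
    rw [mk_mem_tauScale]
    intro t ht
    -- All values of the path lie below its endpoint, which the cone maps place in the scales.
    refine limitScaleZero_lower F (f.ev_mono ht.le) ?_
    rw [← f.endpoint_eq_ev, h]
    exact fun j => (c.π.app j).map_scale x hx
  have hI : ∀ x, α x ∈ limitIdeal F := c.pt.isScale.forall_mem hα.map_sup (isCuIdeal_limitIdeal F)
    fun x hx => subset_idealGen _ (hsc x hx)
  exact ⟨corestrict α _ hI, (isCuIdeal_limitIdeal F).corestrict_isCu (Tau.isCuSemigroup _) hα hI, hsc,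
    fun j x => congrArg (fun s : PomLimit (F ⋙ forgetScale) => s.1 j) (he x)⟩

theorem limitLift_unique {T : Type u} [PosOrdMonoid T] (hT : IsCuSemigroup T) (F : J ⥤ CuSc.{u})
    {α β : T →+o limitIdeal F} (hα : IsCuMorphism α) (hβ : IsCuMorphism β)
    (h : ∀ j x, limitProj F j (α x) = limitProj F j (β x)) : α = β := by
  have := tauLift_unique hT (F ⋙ forgetScale) ((isCuMorphism_limitIdeal_incl F).comp hα)
    ((isCuMorphism_limitIdeal_incl F).comp hβ) h
  exact OrderAddMonoidHom.ext fun x => Subtype.ext (DFunLike.congr_fun this x)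

/-- The ideal that is generated by the limit scale yields limits of scaled Cu-semigroups. -/
noncomputable def limitConeIsLimit (F : J ⥤ CuSc.{u}) (hCu : IsCuSemigroup (limitIdeal F))
    (hsc : IsScale (limitScale F)) (hψ : ∀ j, IsCuMorphism (limitProj F j))
    (hmap : ∀ j, ∀ x ∈ limitScale F, limitProj F j x ∈ (F.obj j).scale) :
    IsLimit (limitCone F hCu hsc hψ hmap) where
  lift c := ⟨⟨(exists_limitLift F c).choose, (exists_limitLift F c).choose_spec.1⟩,
    (exists_limitLift F c).choose_spec.2.1⟩
  fac c j := CuSc.Hom.ext (CuCat.Hom.ext (OrderAddMonoidHom.ext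
    ((exists_limitLift F c).choose_spec.2.2 j)))
  uniq c m hm := CuSc.Hom.ext (CuCat.Hom.ext (limitLift_unique c.pt.toCu.isCu F m.toCu.isCu
    (exists_limitLift F c).choose_spec.1 fun j x => by
      refine Eq.trans ?_ ((exists_limitLift F c).choose_spec.2.2 j x).symm
      exact congrArg (fun f : c.pt ⟶ F.obj j => CuCat.Hom.hom (CuSc.Hom.toCu f) x) (hm j)))

instance : HasLimits CuSc.{u} where
  has_limits_of_shape _ _ :=
    { has_limit := fun F => ⟨⟨_, limitConeIsLimit F (isCuSemigroup_limitIdeal F)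
        (isScale_limitScale F) (isCuMorphism_limitProj F) (limitProj_mem_scale F)⟩⟩ }

end Limit

/-! ### Sub-Cu-semigroups of suprema and their small models -/

section Generated

variable {T : Type u} [PosOrdMonoid T]

/-- The set of suprema of way-below increasing sequences in a given set. -/
def wayBelowSups (A : Set T) : Set T :=
  {x | ∃ s : ℕ → T, (∀ n, s n ∈ A) ∧ (∀ n, WayBelow (s n) (s (n + 1))) ∧ IsLUB (Set.range s) x}

theorem wayBelowSups_add (hT : IsCuSemigroup T) {A : Set T}
    (hA : ∀ x ∈ A, ∀ y ∈ A, x + y ∈ A) {x y : T} (hx : x ∈ wayBelowSups A)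
    (hy : y ∈ wayBelowSups A) : x + y ∈ wayBelowSups A := by
  obtain ⟨s, hsA, hs, hx⟩ := hx
  obtain ⟨t, htA, ht, hy⟩ := hy
  exact ⟨fun n => s n + t n, fun n => hA _ (hsA n) _ (htA n),
    fun n => hT.o3 _ _ _ _ (hs n) (ht n),
    hT.o4 s t (monotone_of_wayBelow hs) (monotone_of_wayBelow ht) x y hx hy⟩

theorem wayBelowSups_zero {A : Set T} (hA : (0 : T) ∈ A) : (0 : T) ∈ wayBelowSups A :=
  ⟨fun _ => 0, fun _ => hA, fun _ => zero_wayBelow 0, by simp⟩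

/-- An element that is the supremum of an increasing sequence of suprema of way-below increasing
sequences in `A` is such a supremum itself. -/
theorem wayBelowSups_seqSupClosed (A : Set T) : SeqSupClosed (wayBelowSups A) := by
  intro x hx hmem z hz
  choose s hsA hs hsx using hmem
  have hm : ∀ n, Monotone (s n) := fun n => monotone_of_wayBelow (hs n)
  have hwb : ∀ n k, WayBelow (s n k) (x n) := fun n k =>
    (hs n k).mono le_rfl ((hsx n).1 ⟨k + 1, rfl⟩)
  -- Indices for a diagonal sequence: the first condition makes it cofinal in all the `s i`, and the
  -- `k + 1` in the second leaves room for a strict way-below step.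
  have step : ∀ n k, ∃ l, (∀ i ≤ n, s i n ≤ s (n + 1) l) ∧ s n (k + 1) ≤ s (n + 1) l := by
    intro n k
    have h : ∀ y, WayBelow y (x (n + 1)) → ∀ᶠ l in Filter.atTop, y ≤ s (n + 1) l := by
      intro y hy
      obtain ⟨l, hl⟩ := hy _ (hm (n + 1)) _ (hsx (n + 1)) le_rfl
      filter_upwards [Filter.eventually_ge_atTop l] with m hlm using hl.trans (hm _ hlm)
    have h1 : ∀ᶠ l in Filter.atTop, ∀ i ∈ Set.Iic n, s i n ≤ s (n + 1) l :=
      (Filter.eventually_all_finite (Set.finite_Iic n)).2 fun i hi =>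
        h _ ((hwb i n).mono le_rfl (hx (le_trans (Set.mem_Iic.1 hi) n.le_succ)))
    have h2 := h _ ((hwb n (k + 1)).mono le_rfl (hx n.le_succ))
    obtain ⟨l, hl1, hl2⟩ := (h1.and h2).exists
    exact ⟨l, fun i hi => hl1 i hi, hl2⟩
  choose φ hφ1 hφ2 using step
  let κ : ℕ → ℕ := fun n => Nat.rec 0 (fun n k => φ n k) n
  have hκ1 : ∀ n, ∀ i ≤ n, s i n ≤ s (n + 1) (κ (n + 1)) := fun n => hφ1 n (κ n)
  have hκ2 : ∀ n, s n (κ n + 1) ≤ s (n + 1) (κ (n + 1)) := fun n => hφ2 n (κ n)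
  refine ⟨fun n => s n (κ n), fun n => hsA _ _, fun n => (hs n _).mono le_rfl (hκ2 n), ?_, ?_⟩
  · rintro _ ⟨n, rfl⟩
    exact (hwb n _).le.trans (hz.1 ⟨n, rfl⟩)
  · intro w hw
    refine hz.2 ?_
    rintro _ ⟨n, rfl⟩
    refine (hsx n).2 ?_
    rintro _ ⟨k, rfl⟩
    refine (hm n (le_max_left k n)).trans ((hκ1 _ n (le_max_right k n)).trans (hw ⟨_, rfl⟩))

/-- The quotient of a type by a setoid, without inherited instances. -/
def QuotientModel {K : Type u} (r : Setoid K) : Type u := Quotient r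

/-- A submonoid that consists of the classes of a type `K`, as an ordered monoid on a quotient of
`K`. -/
theorem exists_quotient_model {K : Type u} (q : K → T) (h0 : (0 : T) ∈ Set.range q)
    (hadd : ∀ x ∈ Set.range q, ∀ y ∈ Set.range q, x + y ∈ Set.range q) :
    ∃ (r : Setoid K) (_ : PosOrdMonoid (QuotientModel r)) (ι : QuotientModel r →+o T),
      (∀ x y, ι x ≤ ι y → x ≤ y) ∧ Set.range ι = Set.range q := by
  let r : Setoid K := Setoid.ker q
  let ι : QuotientModel r → T := Quotient.lift (s := r) q fun _ _ h => h
  have hr : Set.range ι = Set.range q := by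
    ext y
    constructor
    · rintro ⟨⟨k⟩, rfl⟩
      exact ⟨k, rfl⟩
    · rintro ⟨k, rfl⟩
      exact ⟨Quotient.mk r k, rfl⟩
  have hinj : Function.Injective ι := by
    rintro ⟨a⟩ ⟨b⟩ h
    exact Quotient.sound h
  rw [← hr] at h0 hadd
  obtain ⟨z, hz⟩ := h0
  have hadd' : ∀ a b, ∃ c, ι c = ι a + ι b := fun a b => hadd _ ⟨a, rfl⟩ _ ⟨b, rfl⟩
  choose p hp using hadd'
  let inst : PosOrdMonoid (QuotientModel r) :=
    { zero := z
      add := p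
      add_assoc := fun a b c => hinj (by
        change ι (p (p a b) c) = ι (p a (p b c))
        rw [hp, hp, hp, hp, add_assoc])
      zero_add := fun a => hinj ((hp z a).trans (by rw [hz, zero_add]))
      add_zero := fun a => hinj ((hp a z).trans (by rw [hz, add_zero]))
      add_comm := fun a b => hinj (by
        change ι (p a b) = ι (p b a)
        rw [hp, hp, add_comm])
      nsmul := @nsmulRec _ ⟨z⟩ ⟨p⟩
      nsmul_zero := fun _ => rfl
      nsmul_succ := fun _ _ => rfl
      le := fun a b => ι a ≤ ι b
      le_refl := fun a => le_refl (ι a)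
      le_trans := fun a b c h₁ h₂ => le_trans (α := T) h₁ h₂
      le_antisymm := fun a b h₁ h₂ => hinj (le_antisymm h₁ h₂)
      add_le_add_left := fun a b h c => by
        change ι (p a c) ≤ ι (p b c)
        rw [hp, hp]
        exact add_le_add_left (α := T) h _
      zero_le_all := fun a => by
        change ι z ≤ ι a
        rw [hz]
        exact PosOrdMonoid.zero_le_all _ }
  exact ⟨r, inst, ⟨⟨⟨ι, hz⟩, hp⟩, fun _ _ h => h⟩, fun _ _ h => h, hr⟩

end Generated

/-! ### Colimits of Cu-semigroups through a solution set -/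

section Colimit

variable {J : Type u} [SmallCategory J]

/-- Finite sums of elements in the image of a cocone. -/
def coconeSum {F : J ⥤ CuCat.{u}} {T : CuCat.{u}} (σ : ∀ j, F.obj j ⟶ T)
    (l : List (Σ j, (F.obj j).carrier)) : T.carrier :=
  (l.map fun p => CuCat.Hom.hom (σ p.1) p.2).sum

/-- Each summand is approximated inside its own `F.obj j`; Cu-morphisms carry the approximation
over, and (O3), (O4) add it up. -/
theorem coconeSum_mem {F : J ⥤ CuCat.{u}} {T : CuCat.{u}} (σ : ∀ j, F.obj j ⟶ T)
    (l : List (Σ j, (F.obj j).carrier)) : coconeSum σ l ∈ wayBelowSups (Set.range (coconeSum σ)) := by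
  have hadd : ∀ x ∈ Set.range (coconeSum σ), ∀ y ∈ Set.range (coconeSum σ),
      x + y ∈ Set.range (coconeSum σ) := by
    rintro _ ⟨l, rfl⟩ _ ⟨m, rfl⟩
    exact ⟨l ++ m, by simp [coconeSum]⟩
  induction l with
  | nil => exact wayBelowSups_zero ⟨[], rfl⟩
  | cons p l ih =>
    have : coconeSum σ (p :: l) = CuCat.Hom.hom (σ p.1) p.2 + coconeSum σ l := by simp [coconeSum]
    rw [this]
    refine wayBelowSups_add T.isCu hadd ?_ ih
    obtain ⟨s, hs, hp⟩ := (F.obj p.1).isCu.o2 p.2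
    exact ⟨fun n => CuCat.Hom.hom (σ p.1) (s n), fun n => ⟨[⟨p.1, s n⟩], by simp [coconeSum]⟩,
      fun n => (σ p.1).isCu.map_wayBelow _ _ (hs n),
      (σ p.1).isCu.map_sup s (monotone_of_wayBelow hs) _ hp⟩

/-- A morphism into the codomain of an embedding whose range contains the image factors through
the embedding. -/
theorem exists_factor {S M N : Type u} [PosOrdMonoid S] [PosOrdMonoid M] [PosOrdMonoid N]
    {ι : M →+o N} (hι : ∀ x y, ι x ≤ ι y → x ≤ y)
    (hrefl : ∀ x y, WayBelow (ι x) (ι y) → WayBelow x y) {f : S →+o N} (hf : IsCuMorphism f)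
    (h : ∀ x, f x ∈ Set.range ι) : ∃ g : S →+o M, IsCuMorphism g ∧ ∀ x, ι (g x) = f x := by
  choose g hg using h
  have hinj : ∀ x y, ι x = ι y → x = y := fun x y h => le_antisymm (hι _ _ h.le) (hι _ _ h.ge)
  refine ⟨⟨⟨⟨g, hinj _ _ ?_⟩, fun x y => hinj _ _ ?_⟩, fun x y h => hι _ _ ?_⟩, ⟨?_, ?_⟩, hg⟩
  · rw [hg, map_zero, map_zero]
  · change ι (g (x + y)) = ι (g x + g y)
    rw [hg, map_add, map_add, hg, hg]
  · change ι (g x) ≤ ι (g y)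
    rw [hg, hg]
    exact f.monotone' h
  · intro x y h
    refine hrefl _ _ ?_
    change WayBelow (ι (g x)) (ι (g y))
    rw [hg, hg]
    exact hf.map_wayBelow _ _ h
  · intro s hs z hz
    have := hf.map_sup s hs z hz
    refine ⟨?_, fun w hw => hι _ _ ?_⟩
    · rintro _ ⟨n, rfl⟩
      refine hι _ _ ?_
      change ι (g (s n)) ≤ ι (g z)
      rw [hg, hg]
      exact this.1 ⟨n, rfl⟩
    · change ι (g z) ≤ _
      rw [hg]
      refine this.2 ?_
      rintro _ ⟨n, rfl⟩
      change f (s n) ≤ _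
      rw [← hg]
      exact ι.monotone' (hw ⟨n, rfl⟩)

/-- Cocones of Cu-semigroups factor through cocones of bounded size. -/
theorem exists_small_factor (F : J ⥤ CuCat.{u}) (T : CuCat.{u}) (σ : F ⟶ (Functor.const J).obj T) :
    ∃ (r : Setoid (ℕ → List (Σ j, (F.obj j).carrier))) (_ : PosOrdMonoid (QuotientModel r))
      (hCu : IsCuSemigroup (QuotientModel r))
      (τ : F ⟶ (Functor.const J).obj (CuCat.mk (QuotientModel r) hCu))
      (g : CuCat.mk (QuotientModel r) hCu ⟶ T), τ ≫ (Functor.const J).map g = σ := by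
  let σ' : ∀ j, F.obj j ⟶ T := fun j => σ.app j
  let A := Set.range (coconeSum σ')
  have hA0 : (0 : T.carrier) ∈ A := ⟨[], rfl⟩
  have hAadd : ∀ x ∈ A, ∀ y ∈ A, x + y ∈ A := by
    rintro _ ⟨l, rfl⟩ _ ⟨m, rfl⟩
    exact ⟨l ++ m, by simp [coconeSum]⟩
  have hAsub : A ⊆ wayBelowSups A := by
    rintro _ ⟨l, rfl⟩
    exact coconeSum_mem σ' l
  -- Sequences of formal sums parametrize the suprema; a sequence that is not way-below increasing
  -- gets the default value `0`, which is already in the range.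
  have hq : ∀ k : ℕ → List (Σ j, (F.obj j).carrier), ∃ x ∈ wayBelowSups A,
      ∀ y, (∀ n, WayBelow (coconeSum σ' (k n)) (coconeSum σ' (k (n + 1)))) →
        IsLUB (Set.range fun n => coconeSum σ' (k n)) y → x = y := by
    intro k
    by_cases hk : ∀ n, WayBelow (coconeSum σ' (k n)) (coconeSum σ' (k (n + 1)))
    · obtain ⟨x, hx⟩ := T.isCu.o1 _ (monotone_of_wayBelow hk)
      exact ⟨x, ⟨_, fun n => ⟨k n, rfl⟩, hk, hx⟩, fun y _ hy => hx.unique hy⟩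
    · exact ⟨0, wayBelowSups_zero hA0, fun y h => absurd h hk⟩
  choose q hqA hq using hq
  have hrange : Set.range q = wayBelowSups A := by
    ext x
    constructor
    · rintro ⟨k, rfl⟩
      exact hqA k
    · rintro ⟨s, hsA, hs, hx⟩
      choose k hk using hsA
      obtain rfl : (fun n => coconeSum σ' (k n)) = s := funext hk
      exact ⟨k, hq k x hs hx⟩
  obtain ⟨r, inst, ι, hι, hιr⟩ := exists_quotient_model q
    (hrange ▸ wayBelowSups_zero hA0)
    (by rw [hrange]; exact fun x hx y hy => wayBelowSups_add T.isCu hAadd hx hy)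
  rw [hrange] at hιr
  obtain ⟨hCu, hιCu, hrefl⟩ := isCuSemigroup_of_embedding T.isCu ι hι
    (hιr ▸ wayBelowSups_seqSupClosed A) (fun x => by
      have hx : ι x ∈ wayBelowSups A := hιr ▸ ⟨x, rfl⟩
      obtain ⟨s, hsA, hs, hx⟩ := hx
      have hsι : ∀ n, ∃ y, ι y = s n := fun n => by
        have : s n ∈ Set.range ι := hιr ▸ hAsub (hsA n)
        exact this
      choose y hy using hsι
      obtain rfl : (fun n => ι (y n)) = s := funext hy
      exact ⟨y, hs, hx⟩)
  have hfac : ∀ j, ∃ g : (F.obj j).carrier →+o QuotientModel r, IsCuMorphism g ∧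
      ∀ x, ι (g x) = CuCat.Hom.hom (σ' j) x := fun j =>
    exists_factor hι hrefl (σ' j).isCu fun x =>
      hιr ▸ hAsub ⟨[⟨j, x⟩], by simp [coconeSum]⟩
  choose g hgCu hg using hfac
  have hinj : ∀ x y, ι x = ι y → x = y := fun x y h => le_antisymm (hι _ _ h.le) (hι _ _ h.ge)
  refine ⟨r, inst, hCu, ⟨fun j => ⟨g j, hgCu j⟩, fun i j f => ?_⟩, ⟨ι, hιCu⟩, ?_⟩
  · refine CuCat.Hom.ext (OrderAddMonoidHom.ext fun x => hinj _ _ ?_)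
    refine (hg j _).trans (Eq.trans ?_ (hg i x).symm)
    exact congrArg (fun h : F.obj i ⟶ T => CuCat.Hom.hom h x)
      ((σ.naturality f).trans (Category.comp_id _))
  · ext j
    exact CuCat.Hom.ext (OrderAddMonoidHom.ext fun x => hg j x)

/-- All ordered monoid structures on quotients of one fixed type, with all cocones to them, form a
type in the universe `u`. -/
theorem solutionSetCondition_const :
    SolutionSetCondition.{u} (Functor.const J : CuCat.{u} ⥤ J ⥤ CuCat.{u}) := by
  intro F
  refine ⟨Σ (r : Setoid (ℕ → List (Σ j, (F.obj j).carrier))) (_ : PosOrdMonoid (QuotientModel r)),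
    Σ' hCu : IsCuSemigroup (QuotientModel r), F ⟶ (Functor.const J).obj (CuCat.mk (QuotientModel r) hCu),
    fun i => @CuCat.mk (QuotientModel i.1) i.2.1 i.2.2.1, fun i => i.2.2.2, fun T σ => ?_⟩
  obtain ⟨r, inst, hCu, τ, g, h⟩ := exists_small_factor F T σ
  exact ⟨⟨r, inst, hCu, τ⟩, g, h⟩

instance : HasColimits CuCat.{u} where
  has_colimits_of_shape _ _ := hasColimitsOfShape_iff_isRightAdjoint_const.2
    (isRightAdjoint_of_preservesLimits_of_solutionSetCondition _ solutionSetCondition_const)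

/-! ### Colimits of scaled Cu-semigroups -/

section

variable (F : J ⥤ CuSc.{u}) (c : Cocone (F ⋙ forgetScale))

theorem generatedScale_lower : IsLowerSet (generatedScale F c) := fun _ _ h hx =>
  Set.mem_sInter.2 fun A hA => hA.1 h (Set.mem_sInter.1 hx A hA)

theorem generatedScale_seqSupClosed : SeqSupClosed (generatedScale F c) := fun s hs hmem z hz =>
  Set.mem_sInter.2 fun A hA => hA.2.1 s hs (fun n => Set.mem_sInter.1 (hmem n) A hA) z hz

theorem imageScales_subset_generatedScale : imageScales F c ⊆ generatedScale F c := fun _ hx =>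
  Set.mem_sInter.2 fun _ hA => hA.2.2 hx

theorem generatedScale_subset {A : Set c.pt.carrier} (h₁ : IsLowerSet A) (h₂ : SeqSupClosed A)
    (h₃ : imageScales F c ⊆ A) : generatedScale F c ⊆ A := fun _ hx =>
  Set.mem_sInter.1 hx A ⟨h₁, h₂, h₃⟩

/-- The right-hand side is closed under suprema by interpolation, so it contains the generated
scale. Conversely, each of its elements is a supremum of way-below elements, which lie under image
points. -/
theorem generatedScale_eq : generatedScale F c =
    {x | ∀ x', WayBelow x' x → ∃ y ∈ imageScales F c, x' ≤ y} := by
  refine subset_antisymm (generatedScale_subset F c ?_ ?_ ?_) ?_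
  · exact fun x y hyx hx x' hx' => hx x' (hx'.mono le_rfl hyx)
  · intro s hs hmem z hz x' hx'
    obtain ⟨x'', h1, h2⟩ := c.pt.isCu.exists_between hx'
    obtain ⟨n, hn⟩ := h2 s hs z hz le_rfl
    exact hmem n x' (h1.mono le_rfl hn)
  · exact fun x hx x' hx' => ⟨x, hx, hx'.le⟩
  · intro x hx
    obtain ⟨s, hs, hsx, hlub⟩ := c.pt.isCu.exists_approx x
    refine generatedScale_seqSupClosed F c s hs (fun n => ?_) x hlub
    obtain ⟨y, hy, hle⟩ := hx _ (hsx n)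
    exact generatedScale_lower F c hle (imageScales_subset_generatedScale F c hy)

variable {c}

/-- An ideal of a colimit that contains the images of all structure maps is everything. -/
theorem isCuIdeal_eq_top {G : J ⥤ CuCat.{u}} {c : Cocone G} (hc : IsColimit c)
    {I : AddSubmonoid c.pt.carrier} (hI : IsCuIdeal I)
    (h : ∀ j x, CuCat.Hom.hom (c.ι.app j) x ∈ I) : I = ⊤ := by
  obtain ⟨hCu, hincl, -⟩ := hI.embedding c.pt.isCu
  let incl : CuCat.mk I hCu ⟶ c.pt := ⟨submonoidIncl I, hincl⟩
  let d : Cocone G :=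
    { pt := CuCat.mk I hCu
      ι :=
        { app := fun j => ⟨corestrict (CuCat.Hom.hom (c.ι.app j)) I (h j),
            hI.corestrict_isCu c.pt.isCu (c.ι.app j).isCu (h j)⟩
          naturality := fun i j f => CuCat.Hom.ext (OrderAddMonoidHom.ext fun x => Subtype.ext
            (congrArg (fun g : G.obj i ⟶ c.pt => CuCat.Hom.hom g x) (c.w f))) } }
  -- The induced map to the ideal is a section of the inclusion, which is therefore surjective.
  have hid : hc.desc d ≫ incl = 𝟙 c.pt := hc.hom_ext fun j => by
    rw [← Category.assoc, hc.fac, Category.comp_id]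
    rfl
  refine eq_top_iff.2 fun x _ => ?_
  have hx : ((CuCat.Hom.hom (hc.desc d) x : I) : c.pt.carrier) = x :=
    congrArg (fun g : c.pt ⟶ c.pt => CuCat.Hom.hom g x) hid
  exact hx ▸ (CuCat.Hom.hom (hc.desc d) x : I).2

/-- Each scale generates its semigroup, so the ideal generated by the images of the scales contains
the full image of every structure map. -/
theorem isScale_generatedScale (hc : IsColimit c) : IsScale (generatedScale F c) where
  lower := generatedScale_lower F c
  supClosed := generatedScale_seqSupClosed F c
  generates := isCuIdeal_eq_top hc (isCuIdeal_idealGen _) fun j =>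
    (F.obj j).isScale.forall_mem (c.ι.app j).isCu.map_sup (isCuIdeal_idealGen _) fun x hx =>
      subset_idealGen _ (imageScales_subset_generatedScale F c
        (Set.mem_iUnion.2 ⟨j, x, hx, rfl⟩))

theorem map_generatedScale {T : CuSc.{u}} (α : c.pt ⟶ T.toCu)
    (h : ∀ j, ∀ x ∈ (F.obj j).scale, CuCat.Hom.hom (c.ι.app j ≫ α) x ∈ T.scale)
    {x : c.pt.carrier} (hx : x ∈ generatedScale F c) : CuCat.Hom.hom α x ∈ T.scale := by
  refine generatedScale_subset F c (A := CuCat.Hom.hom α ⁻¹' T.scale) ?_ ?_ ?_ hx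
  · exact fun a b hba ha => T.isScale.lower ((CuCat.Hom.hom α).monotone' hba) ha
  · exact fun s hs hmem z hz => T.isScale.supClosed (fun n => CuCat.Hom.hom α (s n))
      (fun _ _ h => (CuCat.Hom.hom α).monotone' (hs h)) hmem _ (α.isCu.map_sup s hs z hz)
  · intro y hy
    obtain ⟨j, z, hz, rfl⟩ := Set.mem_iUnion.1 hy
    exact h j z hz

/-- The generated scale yields colimits of scaled Cu-semigroups. -/
def scaledCoconeIsColimit (hc : IsColimit c) (hsc : IsScale (generatedScale F c)) :
    IsColimit (scaledCocone F c hsc) where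
  desc d := ⟨hc.desc (forgetScale.mapCocone d), fun _ hx => map_generatedScale F (T := d.pt) _
    (fun j x hx => (congrArg (fun g : (F ⋙ forgetScale).obj j ⟶ d.pt.toCu =>
      CuCat.Hom.hom g x ∈ d.pt.scale) (hc.fac (forgetScale.mapCocone d) j)).mpr
        ((d.ι.app j).map_scale x hx)) hx⟩
  fac d j := CuSc.Hom.ext (hc.fac (forgetScale.mapCocone d) j)
  uniq d m hm := CuSc.Hom.ext (hc.uniq (forgetScale.mapCocone d) m.toCu fun j =>
    congrArg CuSc.Hom.toCu (hm j))

end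

instance : HasColimits CuSc.{u} where
  has_colimits_of_shape _ _ :=
    { has_colimit := fun F => ⟨⟨_, scaledCoconeIsColimit F (colimit.isColimit (F ⋙ forgetScale))
        (isScale_generatedScale F (colimit.isColimit _))⟩⟩ }

end Colimit

end Cuntz

theorem mainTheorem3 :
    -- all small limits and all small colimits exist
    (HasLimits Cuntz.CuSc.{u} ∧ HasColimits Cuntz.CuSc.{u}) ∧
    -- limits
    (∀ (J : Type u) [SmallCategory J] (F : J ⥤ Cuntz.CuSc.{u}),
      (∃ (hCu : Cuntz.IsCuSemigroup (Cuntz.Tau (Cuntz.PomLimit (F ⋙ Cuntz.forgetScale))))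
        (hψ : ∀ j, Cuntz.IsCuMorphism (Cuntz.tauProj (F ⋙ Cuntz.forgetScale) j)),
        Nonempty (IsLimit (Cuntz.tauCone (F ⋙ Cuntz.forgetScale) hCu hψ))) ∧
      (∃ (hCu : Cuntz.IsCuSemigroup (Cuntz.limitIdeal F))
        (hsc : Cuntz.IsScale (Cuntz.limitScale F))
        (hψ : ∀ j, Cuntz.IsCuMorphism (Cuntz.limitProj F j))
        (hmap : ∀ j, ∀ x ∈ Cuntz.limitScale F, Cuntz.limitProj F j x ∈ (F.obj j).scale),
        Nonempty (IsLimit (Cuntz.limitCone F hCu hsc hψ hmap)))) ∧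
    -- colimits
    (∀ (J : Type u) [SmallCategory J] (F : J ⥤ Cuntz.CuSc.{u}),
      HasColimit (F ⋙ Cuntz.forgetScale) ∧
      ∀ c : Cocone (F ⋙ Cuntz.forgetScale), IsColimit c →
        Cuntz.generatedScale F c =
          {x | ∀ x', Cuntz.WayBelow x' x → ∃ y ∈ Cuntz.imageScales F c, x' ≤ y} ∧
        ∃ hsc : Cuntz.IsScale (Cuntz.generatedScale F c),
          Nonempty (IsColimit (Cuntz.scaledCocone F c hsc))) := by
  refine ⟨⟨inferInstance, inferInstance⟩, fun J _ F => ⟨?_, ?_⟩, fun J _ F => ⟨inferInstance, ?_⟩⟩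
  · exact ⟨Cuntz.Tau.isCuSemigroup _, Cuntz.isCuMorphism_tauProj _, ⟨Cuntz.tauConeIsLimit _ _ _⟩⟩
  · exact ⟨Cuntz.isCuSemigroup_limitIdeal F, Cuntz.isScale_limitScale F,
      Cuntz.isCuMorphism_limitProj F, Cuntz.limitProj_mem_scale F,
      ⟨Cuntz.limitConeIsLimit F _ _ _ _⟩⟩
  · exact fun c hc => ⟨Cuntz.generatedScale_eq F c, Cuntz.isScale_generatedScale F hc,
      ⟨Cuntz.scaledCoconeIsColimit F hc _⟩⟩
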